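/- **Proposition (Holonomy of $\Sigma$).** Let $\Sigma=\left\{\begin{pmatrix}x&y\\y&-x\end{pmatrix}:x,y\in\mathbb R\right\}\cong\mathbb R^2$, with polar coordinates $(x,y)=(r\cos\phi,r\sin\phi)$, and let $g$ be the cone metric on $\Sigma\setminus\{0\}$, i.e. the pullback of the Euclidean metric of $\mathbb R^3$ under $(x,y)\mapsto(x,y,\sqrt3\,r)$. Let $\nabla$ be its Levi-Civita connection, and consider the $g$-orthonormal frame $$e_1=\cos\phi\,\tfrac{\partial_r}{2}-\sin\phi\,\tfrac{\partial_\phi}{r},\qquad e_2=\sin\phi\,\tfrac{\partial_r}{2}+\cos\phi\,\tfrac{\partial_\phi}{r},$$ with connection form $\omega(X)=g(e_1,\nabla_Xe_2)$. For a curve $\gamma:[0,1]\to\Sigma$ put $$\theta(\gamma)=\int_0^1\omega(\gamma'(t))\,dt\ \text{ (geometric phase)},\qquad W(\gamma;0)=\frac1{2\pi}\int_\gamma d\phi\ \text{ (winding number, possibly non-integer)}.$$ A *loop* at $p\neq0$ is a piecewise smooth curve $\gamma:[0,1]\to\Sigma$ with $\gamma(0)=\gamma(1)=p$ which, whenever it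 passes through the origin, is smooth there with nonzero velocity (this condition is void for loops in $\Sigma\setminus\{0\}$). A vector field along $\gamma$ is *parallel* if it is continuous on $[0,1]$ and satisfies $\nabla_{\gamma'}V=0$ at the times at which $\gamma\neq0$ and $\gamma$ is differentiable. For $U=\Sigma\setminus\{0\}$ or $U=\Sigma$, let $\mathrm{Hol}_p(U)$ be the set of all parallel transports $V(0)\mapsto V(1)$ around loops in $U$ at $p$. A *smooth simple closed curve* is a smooth $1$-periodic map $\gamma:\mathbb R\to\Sigma$ with nowhere vanishing velocity which is injective on $[0,1)$. Let $p\in\Sigma\setminus\{0\}$. For every loop $\gamma$ in $\Sigma$ at $p$ the integrals above exist, $\theta(\gamma)=\pi\,W(\gamma;0)$, and parallel transport around $\gamma$ is a well-defined linear automorphism of $T_p\Sigma$, namely the rotation by the angle $\theta(\gamma)$ in the oriented frame $(e_1(p),e_2(p))$. Moreover: 1. $\mathrm{Hol}_p(\Sigma\setminus\{0\})$ is a group isomorphic to $\mathbb Z_2$. The phases modulo $2\pi$ of the loops in $\Sigma\setminus\{0\}$ at $p$ are exactly the multiples $k\pi$, $k\in\mathbb Z$. There is a smooth simple closed curve in $\Sigma\setminus\{0\}$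 based at $p$ with winding number $1$, and every loop in $\Sigma\setminus\{0\}$ at $p$ with winding number $1$ has phase $\pi$ and its holonomy generates the group. 2. $\mathrm{Hol}_p(\Sigma)$ is a group isomorphic to $\mathbb Z_4$. The phases modulo $2\pi$ of the loops in $\Sigma$ at $p$ are exactly the multiples $k\pi/2$, $k\in\mathbb Z$. Every smooth simple closed curve through the origin has winding number $\tfrac12$ and phase $\tfrac\pi2$, or (with the opposite orientation) winding number $-\tfrac12$ and phase $-\tfrac\pi2$; if it is based at $p$, its holonomy generates the group. There is such a curve based at $p$ with winding number $\tfrac12$. -/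

import Mathlib

open scoped ContDiff

noncomputable section

namespace ConeHolonomy

/-- The coordinate plane `ℝ²`; it also serves as the tangent space of `Σ` at each point, with
respect to the coordinate basis `∂_x, ∂_y`. -/
abbrev Plane : Type := Fin 2 → ℝ

/-- `Σ`, the vector space of real symmetric `2 × 2` matrices of trace zero. -/
def SymTraceless : Submodule ℝ (Matrix (Fin 2) (Fin 2) ℝ) where
  carrier := {A | A.IsSymm ∧ A.trace = 0}
  add_mem' := by
    rintro A B ⟨hA, hA'⟩ ⟨hB, hB'⟩
    exact ⟨hA.add hB, by rw [Matrix.trace_add, hA', hB', add_zero]⟩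
  zero_mem' := ⟨Matrix.isSymm_zero, Matrix.trace_zero _ _⟩
  smul_mem' := by
    rintro a A ⟨hA, hA'⟩
    exact ⟨hA.smul a, by rw [Matrix.trace_smul, hA', smul_zero]⟩

/-- The matrix with rows `(x, y)` and `(y, -x)`. -/
def toMat (q : Plane) : Matrix (Fin 2) (Fin 2) ℝ := !![q 0, q 1; q 1, -q 0]

theorem toMat_mem (q : Plane) : toMat q ∈ SymTraceless := by
  refine ⟨?_, ?_⟩
  · ext i j
    fin_cases i <;> fin_cases j <;> simp [toMat]
  · simp [toMat, Matrix.trace_fin_two]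

/-- The global cartesian chart `Φ` of `Σ`, sending the matrix with rows `(x, y)`, `(y, -x)` to
`(x, y)`. -/
def chart : SymTraceless ≃ₗ[ℝ] Plane where
  toFun A := ![A.1 0 0, A.1 0 1]
  invFun q := ⟨toMat q, toMat_mem q⟩
  map_add' A B := by
    ext i
    fin_cases i <;> simp
  map_smul' a A := by
    ext i
    fin_cases i <;> simp
  left_inv := by
    rintro ⟨A, hA, hA'⟩
    have h1 : A 1 0 = A 0 1 := hA.apply 0 1
    have h2 : A 0 0 + A 1 1 = 0 := by rw [← Matrix.trace_fin_two]; exact hA'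
    apply Subtype.ext
    ext i j
    fin_cases i <;> fin_cases j <;> simp [toMat, h1] <;> linarith
  right_inv q := by
    ext i
    fin_cases i <;> simp [toMat]

/-! ### The cone metric and its Levi-Civita connection

All tensors below are meant on `ℝ² ∖ {0}`; their (junk) values at the origin are never used. -/

/-- The coordinate vector `∂_i`. -/
def coordVec (i : Fin 2) : Plane := Pi.single i 1

/-- The radius `r`. -/
def radius (q : Plane) : ℝ := √(q 0 ^ 2 + q 1 ^ 2)

/-- The parametrization `(x, y) ↦ (x, y, √3 r)` of a cone in `ℝ³`. -/
def coneMap (q : Plane) : Fin 3 → ℝ := ![q 0, q 1, √3 * radius q]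

/-- The Jacobian matrix of the cone parametrization. -/
def coneJacobian (q : Plane) : Matrix (Fin 3) (Fin 2) ℝ :=
  Matrix.of fun k i => fderiv ℝ coneMap q (coordVec i) k

/-- The cone metric `g = Dfᵀ Df`, as the matrix `(g_{ij})`. -/
def metric (q : Plane) : Matrix (Fin 2) (Fin 2) ℝ := (coneJacobian q).transpose * coneJacobian q

/-- `g(X, Y)` at the point `q`. -/
def metricForm (q X Y : Plane) : ℝ := ∑ i, ∑ j, metric q i j * X i * Y j

/-- The partial derivative `∂_i h` at `q`. -/
def partialDeriv (i : Fin 2) (h : Plane → ℝ) (q : Plane) : ℝ := fderiv ℝ h q (coordVec i)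

/-- The Christoffel symbols `Γ^k_{ij}` of the Levi-Civita connection of `g`. -/
def christoffel (q : Plane) (k i j : Fin 2) : ℝ :=
  (1 / 2) * ∑ l, (metric q)⁻¹ k l *
    (partialDeriv i (fun z => metric z j l) q + partialDeriv j (fun z => metric z i l) q
      - partialDeriv l (fun z => metric z i j) q)

/-- The vector with components `Γ^k_{ij} X^i Y^j`. -/
def christoffelForm (q X Y : Plane) : Plane :=
  fun k => ∑ i, ∑ j, christoffel q k i j * X i * Y j

/-- The Levi-Civita covariant derivative `∇_X Y` at `q` of a vector field `Y`. -/
def covDeriv (q X : Plane) (Y : Plane → Plane) : Plane :=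
  fderiv ℝ Y q X + christoffelForm q X (Y q)

/-! ### The reference frame and the connection form -/

/-- `∂_r = cos φ ∂_x + sin φ ∂_y`. -/
def polarR (q : Plane) : Plane := ![q 0 / radius q, q 1 / radius q]

/-- `∂_φ = - r sin φ ∂_x + r cos φ ∂_y`. -/
def polarPhi (q : Plane) : Plane := ![-q 1, q 0]

/-- `e₁ = cos φ ∂_r / 2 - sin φ ∂_φ / r`. -/
def frameOne (q : Plane) : Plane :=
  (q 0 / radius q) • ((1 / 2 : ℝ) • polarR q) - (q 1 / radius q) • ((1 / radius q) • polarPhi q)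

/-- `e₂ = sin φ ∂_r / 2 + cos φ ∂_φ / r`. -/
def frameTwo (q : Plane) : Plane :=
  (q 1 / radius q) • ((1 / 2 : ℝ) • polarR q) + (q 0 / radius q) • ((1 / radius q) • polarPhi q)

/-- The connection form `ω(X) = g(e₁, ∇_X e₂)` at `q`. -/
def connectionForm (q X : Plane) : ℝ := metricForm q (frameOne q) (covDeriv q X frameTwo)

/-- The angular form `dφ(X) = (x X² - y X¹) / r²` at `q`. -/
def angularForm (q X : Plane) : ℝ := (q 0 * X 1 - q 1 * X 0) / (q 0 ^ 2 + q 1 ^ 2)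

/-! ### Curves

A curve in `Σ` is a function `c : ℝ → Σ`, considered on `[0, 1]`. -/

/-- The coordinate expression of a curve. -/
def coords (c : ℝ → SymTraceless) (t : ℝ) : Plane := chart (c t)

/-- The velocity, in coordinates. -/
def velocity (c : ℝ → SymTraceless) (t : ℝ) : Plane := deriv (coords c) t

/-- The integrand `ω(c'(t))` of the geometric phase. -/
def phaseDensity (c : ℝ → SymTraceless) (t : ℝ) : ℝ := connectionForm (coords c t) (velocity c t)

/-- The geometric phase `θ(c) = ∫₀¹ ω(c'(t)) dt`. -/
def geometricPhase (c : ℝ → SymTraceless) : ℝ := ∫ t in (0 : ℝ)..1, phaseDensity c t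

/-- The integrand `dφ(c'(t))` of the winding number. -/
def angularSpeed (c : ℝ → SymTraceless) (t : ℝ) : ℝ := angularForm (coords c t) (velocity c t)

/-- The (possibly non-integer) winding number `W(c; 0) = (1 / 2π) ∫ dφ`. -/
def windingNumber (c : ℝ → SymTraceless) : ℝ :=
  (1 / (2 * Real.pi)) * ∫ t in (0 : ℝ)..1, angularSpeed c t

/-- `c` is piecewise smooth on `[0, 1]`: there are `0 = τ₀ < τ₁ < ... < τₙ = 1` such that `c` is
smooth on each closed interval `[τᵢ, τᵢ₊₁]`. -/
def IsPiecewiseSmooth (c : ℝ → SymTraceless) : Prop :=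
  ∃ (n : ℕ) (τ : Fin (n + 1) → ℝ), StrictMono τ ∧ τ 0 = 0 ∧ τ (Fin.last n) = 1 ∧
    ∀ i : Fin n, ContDiffOn ℝ ∞ (coords c) (Set.Icc (τ i.castSucc) (τ i.succ))

/-- `c` traverses the origin only as a smooth regular curve: whenever it is at `0` (at an interior
time), it is smooth there and has nonzero velocity.  The condition is void for curves that avoid
the origin. -/
def CrossesOriginRegularly (c : ℝ → SymTraceless) : Prop :=
  ∀ t ∈ Set.Icc (0 : ℝ) 1, c t = 0 →
    t ∈ Set.Ioo (0 : ℝ) 1 ∧ ContDiffAt ℝ ∞ (coords c) t ∧ velocity c t ≠ 0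

/-- Loops in `U ⊆ Σ` based at `p`: piecewise smooth closed curves which may go through the origin
only smoothly and with nonzero velocity. -/
structure IsLoop (U : Set SymTraceless) (p : SymTraceless) (c : ℝ → SymTraceless) : Prop where
  start : c 0 = p
  finish : c 1 = p
  inside : ∀ t ∈ Set.Icc (0 : ℝ) 1, c t ∈ U
  piecewiseSmooth : IsPiecewiseSmooth c
  regular : CrossesOriginRegularly c

/-- Smooth simple closed curves: regular, smoothly closed up (that is, `1`-periodic), and without
self-intersections. -/
structure IsSmoothSimpleClosed (c : ℝ → SymTraceless) : Prop where
  smooth : ContDiff ℝ ∞ (coords c)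
  periodic : Function.Periodic c 1
  regular : ∀ t, velocity c t ≠ 0
  simple : Set.InjOn c (Set.Ico 0 1)

/-! ### Parallel transport and holonomy -/

/-- `V` is a parallel vector field along `c`: it is continuous on `[0, 1]`, and away from the
origin it satisfies `∇_{c'} V = 0`, that is, `V' + Γ(c', V) = 0` (wherever `c` has a
velocity). -/
def IsParallelAlong (c : ℝ → SymTraceless) (V : ℝ → Plane) : Prop :=
  ContinuousOn V (Set.Icc 0 1) ∧
    ∀ t ∈ Set.Ioo (0 : ℝ) 1, c t ≠ 0 → DifferentiableAt ℝ (coords c) t →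
      HasDerivAt V (-christoffelForm (coords c t) (velocity c t) (V t)) t

/-- `T` is the parallel transport along `c` from `t = 0` to `t = 1`: the graph of `T` consists of
the pairs `(V 0, V 1)` of boundary values of parallel vector fields `V` along `c`. -/
def IsParallelTransport (c : ℝ → SymTraceless) (T : Plane ≃ₗ[ℝ] Plane) : Prop :=
  ∀ v w : Plane, T v = w ↔ ∃ V : ℝ → Plane, IsParallelAlong c V ∧ V 0 = v ∧ V 1 = w

/-- The holonomy of `U ⊆ Σ` at `p`: all parallel transports around loops in `U` based at `p`. -/
def holonomy (U : Set SymTraceless) (p : SymTraceless) : Set (Plane ≃ₗ[ℝ] Plane) :=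
  {T | ∃ c, IsLoop U p c ∧ IsParallelTransport c T}

/-- The geometric phases modulo `2π` of all loops in `U` based at `p`. -/
def phases (U : Set SymTraceless) (p : SymTraceless) : Set Real.Angle :=
  {a | ∃ c, IsLoop U p c ∧ a = (geometricPhase c : Real.Angle)}

/-- `T` is the rotation by the angle `θ` of the tangent space at `p`, measured in the reference
frame `(e₁, e₂)`. -/
def IsFrameRotation (p : SymTraceless) (θ : ℝ) (T : Plane ≃ₗ[ℝ] Plane) : Prop :=
  T (frameOne (chart p)) = Real.cos θ • frameOne (chart p) + Real.sin θ • frameTwo (chart p) ∧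
  T (frameTwo (chart p)) = -Real.sin θ • frameOne (chart p) + Real.cos θ • frameTwo (chart p)

end ConeHolonomy

end

noncomputable section

namespace ConeHolonomy

/-! ### The Levi-Civita connection of the cone metric -/

/-! The metric is `4 dr² + r² dφ²`, a flat cone on which a full turn about the apex counts only
half. Accordingly `ω = dφ / 2` (`connectionForm_eq`), so the phase is half the swept angle, that is
`π W`, and the frame coefficient of a parallel field is multiplied by `exp (i A / 2)`, where `A` is
the angle swept so far.

At the origin everything is singular except the squared direction `u = z / conj z`. The frame at `z`
is `w ↦ (3 w - u conj w) / 4`, so it depends on `z` only through `u`, and `u` does not distinguish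
`z` from `-z`. A regular curve leaves the origin opposite to where it came from, hence `u` extends
continuously by the squared direction of the velocity. The angular speed stays bounded there, so `A`
is continuous, `u (t) = exp (2 i A (t)) u (0)` persists through the origin
(`IsRegularCurve.curveSqDir_eq`), and so does the transport (`IsLoop.isParallelTransport`).

For a closed curve `exp (2 i A) = 1`, so `A ∈ π ℤ` and the phase lies in `(π / 2) ℤ`; if the origin
is avoided, `A ∈ 2 π ℤ` and the phase lies in `π ℤ`. Multiply covered circles, centred at the origin
or through it, realize all these values. Rotation in the frame at `p` is an injective homomorphism
from the circle, so the holonomy groups are cyclic of the orders of `exp (i π)` and `exp (i π / 2)`.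
For a simple closed curve through the origin, Hopf's chord argument gives `A = ± π`
(`integral_angSpeed_of_simple_closed`). -/

theorem normSq_pos {q : Plane} (hq : q ≠ 0) : 0 < q 0 ^ 2 + q 1 ^ 2 := by
  by_contra h
  apply hq
  ext i
  fin_cases i
  · simp only [Fin.zero_eta, Pi.zero_apply]; nlinarith [sq_nonneg (q 0), sq_nonneg (q 1)]
  · simp only [Fin.mk_one, Pi.zero_apply]; nlinarith [sq_nonneg (q 0), sq_nonneg (q 1)]

theorem radius_pos {q : Plane} (hq : q ≠ 0) : 0 < radius q := Real.sqrt_pos.2 (normSq_pos hq)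

theorem radius_sq (q : Plane) : radius q ^ 2 = q 0 ^ 2 + q 1 ^ 2 := Real.sq_sqrt (by positivity)

/-- The `i`-th coordinate function. -/
def coordCLM (i : Fin 2) : Plane →L[ℝ] ℝ := ContinuousLinearMap.proj i

@[simp] theorem coordCLM_apply (i : Fin 2) (q : Plane) : coordCLM i q = q i := rfl

theorem hasFDerivAt_coord (i : Fin 2) (q : Plane) :
    HasFDerivAt (fun z : Plane => z i) (coordCLM i) q :=
  (coordCLM i).hasFDerivAt

theorem hasFDerivAt_normSq (q : Plane) :
    HasFDerivAt (fun z : Plane => z 0 ^ 2 + z 1 ^ 2)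
      ((2 * q 0) • coordCLM 0 + (2 * q 1) • coordCLM 1) q := by
  have h := ((hasFDerivAt_coord 0 q).pow 2).add ((hasFDerivAt_coord 1 q).pow 2)
  convert! h using 1
  ext v
  simp

theorem hasFDerivAt_radius {q : Plane} (hq : q ≠ 0) :
    HasFDerivAt radius
      ((q 0 / radius q) • coordCLM 0 +
        (q 1 / radius q) • coordCLM 1) q := by
  have h := (hasFDerivAt_normSq q).sqrt (normSq_pos hq).ne'
  have hr := (radius_pos hq).ne'
  convert! h using 1
  ext v
  change _ = 1 / (2 * radius q) * (2 * q 0 * v 0 + 2 * q 1 * v 1)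
  simp only [add_apply, smul_apply,
    coordCLM_apply, smul_eq_mul]
  field_simp

theorem hasFDerivAt_coneMap {q : Plane} (hq : q ≠ 0) :
    HasFDerivAt coneMap
      (ContinuousLinearMap.pi ![coordCLM 0, coordCLM 1,
        √3 • ((q 0 / radius q) • coordCLM 0 +
          (q 1 / radius q) • coordCLM 1)]) q := by
  rw [hasFDerivAt_pi]
  intro k
  fin_cases k
  · exact hasFDerivAt_coord 0 q
  · exact hasFDerivAt_coord 1 q
  · exact (hasFDerivAt_radius hq).const_mul √3

theorem metric_eq {q : Plane} (hq : q ≠ 0) (i j : Fin 2) :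
    metric q i j = (if i = j then 1 else 0) + 3 * (q i * q j / (q 0 ^ 2 + q 1 ^ 2)) := by
  have hr := radius_pos hq
  have h3 : √3 ^ 2 = (3 : ℝ) := Real.sq_sqrt (by norm_num)
  simp only [metric, Matrix.mul_apply, Fin.sum_univ_three, Matrix.transpose_apply, coneJacobian,
    Matrix.of_apply, (hasFDerivAt_coneMap hq).fderiv, ← radius_sq]
  fin_cases i <;> fin_cases j <;> simp [coordVec] <;> field_simp <;> rw [h3] <;> ring

/-- These functions are homogeneous of degree `0`, so only the angular part of `X` contributes, and
`polarPhi` is the derivative of `q` under rotation. The metric and both frame fields are affine in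
them, so all later derivatives reduce to this one. -/
theorem hasFDerivAt_coord_mul_coord_div {q : Plane} (hq : q ≠ 0) (i j : Fin 2) :
    ∃ L : Plane →L[ℝ] ℝ,
      HasFDerivAt (fun z : Plane => z i * z j / (z 0 ^ 2 + z 1 ^ 2)) L q ∧
      ∀ X, L X = angularForm q X / (q 0 ^ 2 + q 1 ^ 2) *
        (polarPhi q i * q j + q i * polarPhi q j) := by
  have hn := (normSq_pos hq).ne'
  have h := ((hasFDerivAt_coord i q).mul (hasFDerivAt_coord j q)).mul
    ((hasDerivAt_inv hn).comp_hasFDerivAt q (hasFDerivAt_normSq q))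
  refine ⟨_, h, fun X => ?_⟩
  fin_cases i <;> fin_cases j <;> simp [angularForm, polarPhi] <;> field_simp <;> ring

theorem partialDeriv_metric {q : Plane} (hq : q ≠ 0) (l i j : Fin 2) :
    partialDeriv l (fun z => metric z i j) q = 3 * (angularForm q (coordVec l) /
      (q 0 ^ 2 + q 1 ^ 2) * (polarPhi q i * q j + q i * polarPhi q j)) := by
  obtain ⟨L, hL, hL'⟩ := hasFDerivAt_coord_mul_coord_div hq i j
  have h : (fun z => metric z i j) =ᶠ[nhds q] fun z =>
      (if i = j then 1 else 0) + 3 * (z i * z j / (z 0 ^ 2 + z 1 ^ 2)) := by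
    filter_upwards [isOpen_ne.mem_nhds hq] with z hz using metric_eq hz i j
  rw [partialDeriv, h.fderiv_eq, ((hL.const_mul 3).const_add _).fderiv]
  simp [hL']

/-- The metric is the identity plus three times the radial projection: its radial eigenvalue is `4`,
whence the coefficient `1 / 4 - 1 = -3 / 4`. -/
theorem metric_inv_eq {q : Plane} (hq : q ≠ 0) :
    (metric q)⁻¹ = Matrix.of fun i j =>
      (if i = j then 1 else 0) - 3 / 4 * (q i * q j / (q 0 ^ 2 + q 1 ^ 2)) := by
  have hn := (normSq_pos hq).ne'
  apply Matrix.inv_eq_right_inv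
  ext i j
  simp only [Matrix.mul_apply, Fin.sum_univ_two, metric_eq hq, Matrix.of_apply]
  fin_cases i <;> fin_cases j <;> simp <;> field_simp <;> ring

/-- In polar coordinates the only symbol that differs from the Euclidean one is `Γ^r_{φφ}`, which is
`-r / 4` instead of `-r`. The difference `(3 / 4) r ∂_r` is `(3 / 4) q`, and the Euclidean symbols
vanish in cartesian coordinates. -/
theorem christoffelForm_eq {q : Plane} (hq : q ≠ 0) (X Y : Plane) :
    christoffelForm q X Y = (3 / 4 * angularForm q X * angularForm q Y) • q := by
  have hn := (normSq_pos hq).ne'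
  ext k
  simp only [christoffelForm, christoffel, Fin.sum_univ_two, metric_inv_eq hq,
    partialDeriv_metric hq, Matrix.of_apply, Pi.smul_apply, smul_eq_mul]
  fin_cases k <;> simp [angularForm, polarPhi, coordVec] <;> field_simp <;> ring

theorem frameOne_eq {q : Plane} (hq : q ≠ 0) : frameOne q =
    ![1 - q 0 * q 0 / (q 0 ^ 2 + q 1 ^ 2) / 2, -(q 0 * q 1 / (q 0 ^ 2 + q 1 ^ 2)) / 2] := by
  have hr := (radius_pos hq).ne'
  have h := radius_sq q
  ext k
  simp only [← radius_sq]
  fin_cases k <;> simp [frameOne, polarR, polarPhi] <;> field_simp <;>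
    first | ring1 | linear_combination -2 * h

theorem frameTwo_eq {q : Plane} (hq : q ≠ 0) : frameTwo q =
    ![-(q 0 * q 1 / (q 0 ^ 2 + q 1 ^ 2)) / 2, 1 - q 1 * q 1 / (q 0 ^ 2 + q 1 ^ 2) / 2] := by
  have hr := (radius_pos hq).ne'
  have h := radius_sq q
  ext k
  simp only [← radius_sq]
  fin_cases k <;> simp [frameTwo, polarR, polarPhi] <;> field_simp <;>
    first | ring1 | linear_combination -2 * h

/-- The polar frame `∂_r / 2, ∂_φ / r` turns at half the Euclidean rate, and turning it back by `φ`
contributes a full unit, which leaves `1 - 1 / 2`. -/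
theorem covDeriv_frameTwo {q : Plane} (hq : q ≠ 0) (X : Plane) :
    covDeriv q X frameTwo = (angularForm q X / 2) • frameOne q := by
  have hn := (normSq_pos hq).ne'
  obtain ⟨L, hL, hL'⟩ := hasFDerivAt_coord_mul_coord_div hq 0 1
  obtain ⟨M, hM, hM'⟩ := hasFDerivAt_coord_mul_coord_div hq 1 1
  have h : frameTwo =ᶠ[nhds q] fun z : Plane =>
      ![-(z 0 * z 1 / (z 0 ^ 2 + z 1 ^ 2)) / 2, 1 - z 1 * z 1 / (z 0 ^ 2 + z 1 ^ 2) / 2] := by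
    filter_upwards [isOpen_ne.mem_nhds hq] with z hz using frameTwo_eq hz
  have hd : HasFDerivAt (fun z : Plane =>
      (![-(z 0 * z 1 / (z 0 ^ 2 + z 1 ^ 2)) / 2,
        1 - z 1 * z 1 / (z 0 ^ 2 + z 1 ^ 2) / 2] : Plane))
      (ContinuousLinearMap.pi ![-((1 / 2 : ℝ) • L), -((1 / 2 : ℝ) • M)]) q := by
    rw [hasFDerivAt_pi]
    intro k
    fin_cases k
    · convert! (hL.const_mul (1 / 2)).neg using 1
      ext z; simp; ring
    · convert! (hM.const_mul (1 / 2)).const_sub 1 using 1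
      ext z; simp; ring
  rw [covDeriv, christoffelForm_eq hq, h.fderiv_eq, hd.fderiv, frameTwo_eq hq, frameOne_eq hq]
  ext k
  fin_cases k <;> simp [hL', hM', angularForm, polarPhi] <;> field_simp <;> ring

theorem metricForm_frameOne {q : Plane} (hq : q ≠ 0) :
    metricForm q (frameOne q) (frameOne q) = 1 := by
  have hn := (normSq_pos hq).ne'
  simp only [metricForm, Fin.sum_univ_two, metric_eq hq, frameOne_eq hq]
  simp
  field_simp
  ring

/-- The connection form is half the angular form. -/
theorem connectionForm_eq {q : Plane} (hq : q ≠ 0) (X : Plane) :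
    connectionForm q X = angularForm q X / 2 := by
  have h : ∀ a : ℝ, metricForm q (frameOne q) (a • frameOne q) =
      a * metricForm q (frameOne q) (frameOne q) := by
    intro a
    simp only [metricForm, Fin.sum_univ_two, Pi.smul_apply, smul_eq_mul]
    ring
  rw [connectionForm, covDeriv_frameTwo hq, h, metricForm_frameOne hq, mul_one]

/-! ### The angle swept out by a plane curve -/

open MeasureTheory Filter Topology Set

/-- The angular speed `Im (z' / z)` of a plane curve about the origin; it vanishes at the zeros
of `z`. -/
def angSpeed (z : ℝ → ℂ) (t : ℝ) : ℝ := (deriv z t / z t).im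

/-- The angle swept out by a plane curve from time `0` on. -/
def angle (z : ℝ → ℂ) (t : ℝ) : ℝ := ∫ s in (0 : ℝ)..t, angSpeed z s

/-- The square of the direction of a complex number. -/
def sqDir (w : ℂ) : ℂ := w / (starRingEnd ℂ) w

/-- The squared direction of a plane curve, extended to its zeros by the squared direction of the
velocity. -/
def curveSqDir (z : ℝ → ℂ) (t : ℝ) : ℂ := sqDir (if z t = 0 then deriv z t else z t)

/-- Piecewise continuously differentiable plane curves on `[0, 1]` which traverse the origin only
as regular `C²` curves. -/
structure IsRegularCurve (z : ℝ → ℂ) : Prop where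
  continuousOn : ContinuousOn z (Icc 0 1)
  exists_finite : ∃ S : Set ℝ, S.Finite ∧ ∃ M : ℝ, ∀ t ∈ Ioo 0 1 \ S,
    DifferentiableAt ℝ z t ∧ ContinuousAt (deriv z) t ∧ ‖deriv z t‖ ≤ M
  crossing : ∀ t ∈ Icc (0 : ℝ) 1, z t = 0 → t ∈ Ioo 0 1 ∧ ContDiffAt ℝ 2 z t ∧ deriv z t ≠ 0

/-- Negative factors are included: this is why the direction is squared, as the two sides of a
passage through the origin have opposite directions. -/
theorem sqDir_real_mul {a : ℝ} (ha : a ≠ 0) (w : ℂ) : sqDir (a * w) = sqDir w := by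
  have ha' : (a : ℂ) ≠ 0 := by exact_mod_cast ha
  simp only [sqDir, map_mul, Complex.conj_ofReal]
  rw [mul_div_mul_left _ _ ha']

theorem norm_sqDir {w : ℂ} (hw : w ≠ 0) : ‖sqDir w‖ = 1 := by
  rw [sqDir, norm_div, Complex.norm_conj, div_self (norm_ne_zero_iff.2 hw)]

theorem continuousAt_sqDir {w : ℂ} (hw : w ≠ 0) : ContinuousAt sqDir w := by
  unfold sqDir
  exact continuousAt_id.div Complex.continuous_conj.continuousAt
    ((map_ne_zero _).2 hw)

theorem hasDerivAt_conj_comp {z : ℝ → ℂ} {z' : ℂ} {t : ℝ} (h : HasDerivAt z z' t) :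
    HasDerivAt (fun s => (starRingEnd ℂ) (z s)) ((starRingEnd ℂ) z') t :=
  Complex.conjCLE.toContinuousLinearMap.hasFDerivAt.comp_hasDerivAt t h

/-- The logarithmic derivative of `z / conj z` is `z' / z` minus its conjugate, that is `2 i Im (z'
/ z)`. -/
theorem hasDerivAt_sqDir_comp {z : ℝ → ℂ} {t : ℝ} (hz : z t ≠ 0) (hd : DifferentiableAt ℝ z t) :
    HasDerivAt (fun s => sqDir (z s)) (2 * Complex.I * angSpeed z t * sqDir (z t)) t := by
  have h1 := hd.hasDerivAt
  have hc : (starRingEnd ℂ) (z t) ≠ 0 := (map_ne_zero _).2 hz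
  have h := h1.div (hasDerivAt_conj_comp h1) hc
  convert! h using 1
  have him : (2 * Complex.I * angSpeed z t : ℂ) =
      deriv z t / z t - (starRingEnd ℂ) (deriv z t / z t) := by
    rw [Complex.sub_conj, angSpeed]
    push_cast
    ring
  rw [him, map_div₀, sqDir]
  field_simp

theorem IsRegularCurve.eventually_ne_zero {z : ℝ → ℂ} (h : IsRegularCurve z) {t : ℝ}
    (ht : t ∈ Icc (0 : ℝ) 1) (hz : z t = 0) : ∀ᶠ s in 𝓝[≠] t, z s ≠ 0 := by
  obtain ⟨-, h2, h3⟩ := h.crossing t ht hz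
  exact (h2.differentiableAt (by norm_num)).hasDerivAt.eventually_ne h3

/-- Nonzero velocity isolates each zero; on a compact interval infinitely many would accumulate at
another zero. -/
theorem IsRegularCurve.finite_zeros {z : ℝ → ℂ} (h : IsRegularCurve z) :
    {t ∈ Icc (0 : ℝ) 1 | z t = 0}.Finite := by
  by_contra hinf
  obtain ⟨t, ht, hacc⟩ := Set.Infinite.exists_accPt_of_subset_isCompact hinf
    (isCompact_Icc (a := (0 : ℝ)) (b := 1)) (fun s hs => hs.1)
  have hclosed : IsClosed {t ∈ Icc (0 : ℝ) 1 | z t = 0} :=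
    h.continuousOn.preimage_isClosed_of_isClosed isClosed_Icc isClosed_singleton
  have htz := isClosed_iff_accPt.1 hclosed t hacc
  have := accPt_iff_frequently_nhdsNE.1 hacc
  exact this ((h.eventually_ne_zero htz.1 htz.2).mono fun s hs hs' => hs hs'.2)

theorem sqDir_slope_eq {z : ℝ → ℂ} {t s : ℝ} (hz : z t = 0) (hs : s ≠ t) :
    sqDir (slope z t s) = sqDir (z s) := by
  have : slope z t s = ((s - t)⁻¹ : ℝ) * z s := by
    rw [slope_def_module, hz, sub_zero, Complex.real_smul]
  rw [this, sqDir_real_mul (inv_ne_zero (sub_ne_zero.2 hs))]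

/-- Near a zero, `z s` is a real multiple of the slope of `z`, which tends to the nonzero velocity;
the sign change of the factor is lost in the square. -/
theorem IsRegularCurve.continuousOn_curveSqDir {z : ℝ → ℂ} (h : IsRegularCurve z) :
    ContinuousOn (curveSqDir z) (Icc 0 1) := by
  intro t ht
  by_cases hz : z t = 0
  · obtain ⟨-, h2, h3⟩ := h.crossing t ht hz
    apply ContinuousAt.continuousWithinAt
    rw [continuousAt_iff_punctured_nhds]
    have h1 := hasDerivAt_iff_tendsto_slope.1 (h2.differentiableAt (by norm_num)).hasDerivAt
    have h4 := (continuousAt_sqDir h3).tendsto.comp h1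
    have h5 : curveSqDir z t = sqDir (deriv z t) := by rw [curveSqDir, if_pos hz]
    rw [h5]
    refine h4.congr' ?_
    filter_upwards [h.eventually_ne_zero ht hz, self_mem_nhdsWithin] with s hs hst
    rw [curveSqDir, if_neg hs, Function.comp_apply, sqDir_slope_eq hz hst]
  · have h1 : ContinuousWithinAt (fun s => sqDir (z s)) (Icc 0 1) t :=
      (continuousAt_sqDir hz).comp_continuousWithinAt (h.continuousOn t ht)
    refine h1.congr_of_eventuallyEq ?_ (by rw [curveSqDir, if_neg hz])
    filter_upwards [(h.continuousOn t ht).eventually_ne hz] with s hs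
    rw [curveSqDir, if_neg hs]

theorem norm_curveSqDir {z : ℝ → ℂ} (h : IsRegularCurve z) {t : ℝ} (ht : t ∈ Icc (0 : ℝ) 1) :
    ‖curveSqDir z t‖ = 1 := by
  apply norm_sqDir
  split_ifs with hz
  · exact (h.crossing t ht hz).2.2
  · exact hz

/-- The angular speed of a regular `C²` curve stays bounded near a passage through the origin. -/
theorem eventually_abs_angSpeed_le {z : ℝ → ℂ} {t : ℝ} (hz : z t = 0) (h2 : ContDiffAt ℝ 2 z t)
    (h3 : deriv z t ≠ 0) : ∃ C : ℝ, ∀ᶠ s in 𝓝 t, |angSpeed z s| ≤ C := by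
  have hd : ContDiffAt ℝ 1 (deriv z) t := by
    have := (h2.fderiv_right (m := 1) (by norm_num)).clm_apply (contDiffAt_const (c := (1 : ℝ)))
    exact this
  obtain ⟨K, u, hu, hK⟩ := hd.exists_lipschitzOnWith
  have hrev := (h2.differentiableAt (by norm_num)).hasDerivAt.isTheta_sub h3
  obtain ⟨c, hc0, hc⟩ := hrev.2.exists_pos
  have hcb : ∀ᶠ s in 𝓝 t, ‖s - t‖ ≤ c * ‖z s - z t‖ := by
    simpa only [prod_pure, eventually_map] using hc.bound
  have hdiff : ∀ᶠ s in 𝓝 t, DifferentiableAt ℝ z s := by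
    filter_upwards [h2.eventually (by norm_num)] with s hs using hs.differentiableAt (by norm_num)
  obtain ⟨δ, hδ, hball⟩ := Metric.eventually_nhds_iff_ball.1
    (hdiff.and (eventually_mem_set.2 hu))
  refine ⟨K * c, ?_⟩
  filter_upwards [hcb, Metric.ball_mem_nhds t hδ] with s hs hsb
  rw [hz, sub_zero] at hs
  rcases eq_or_ne s t with rfl | hst
  · rw [angSpeed, hz, div_zero, Complex.zero_im, abs_zero]
    positivity
  have hst' : 0 < ‖s - t‖ := norm_pos_iff.2 (sub_ne_zero.2 hst)
  have hzs : 0 < ‖z s‖ := by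
    by_contra hcon
    nlinarith [norm_nonneg (z s)]
  have hsub : uIcc t s ⊆ Metric.ball t δ :=
    (convex_ball t δ).ordConnected.uIcc_subset (Metric.mem_ball_self hδ) hsb
  -- First-order Taylor expansion at `s`, not at `t`: the velocity is Lipschitz, so `z s - (s - t)
  -- z' (s)` is of second order in `s - t`.
  have hmv : ‖(z s - s * deriv z s) - (z t - t * deriv z s)‖ ≤ K * ‖s - t‖ * ‖s - t‖ := by
    refine (convex_uIcc t s).norm_image_sub_le_of_norm_hasDerivWithin_le
      (f := fun r : ℝ => z r - r * deriv z s) (f' := fun r => deriv z r - deriv z s)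
      (fun r hr => ?_) (fun r hr => ?_) left_mem_uIcc right_mem_uIcc
    · have h1 := (hball r (hsub hr)).1.hasDerivAt.sub
        ((hasDerivAt_id r).ofReal_comp.mul_const (deriv z s))
      convert! h1.hasDerivWithinAt using 1
      simp
    · have h1 := hK.norm_sub_le (hball r (hsub hr)).2 (hball s hsb).2
      refine h1.trans ?_
      gcongr
      rw [Real.norm_eq_abs, Real.norm_eq_abs, abs_sub_comm r s]
      exact abs_sub_right_of_mem_uIcc hr
  have hne : z s ≠ 0 := norm_pos_iff.1 hzs
  have hne' : ((s : ℂ) - t) ≠ 0 := by exact_mod_cast sub_ne_zero.2 hst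
  -- The real number `1 / (s - t)` may be subtracted from `z' / z` without changing the imaginary
  -- part. It removes the pole, leaving a second-order numerator over `z s * (s - t)`, which is of
  -- order exactly two.
  have him : angSpeed z s =
      (-((z s - s * deriv z s) - (z t - t * deriv z s)) / (z s * ((s - t : ℝ) : ℂ))).im := by
    have h1 : -((z s - s * deriv z s) - (z t - t * deriv z s)) / (z s * ((s - t : ℝ) : ℂ)) =
        deriv z s / z s - (((s - t)⁻¹ : ℝ) : ℂ) := by
      rw [hz]
      push_cast
      field_simp
      ring
    rw [h1, Complex.sub_im, Complex.ofReal_im, sub_zero, angSpeed]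
  rw [him]
  refine (Complex.abs_im_le_norm _).trans ?_
  rw [norm_div, norm_neg, norm_mul, Complex.norm_real, div_le_iff₀ (by positivity)]
  refine hmv.trans ?_
  have : (K : ℝ) * ‖s - t‖ * ‖s - t‖ ≤ K * (c * ‖z s‖) * ‖s - t‖ := by gcongr
  linarith

theorem IsRegularCurve.exists_abs_angSpeed_le {z : ℝ → ℂ} (h : IsRegularCurve z) {S : Set ℝ}
    {M : ℝ} (hM : ∀ t ∈ Ioo 0 1 \ S, ‖deriv z t‖ ≤ M) {t : ℝ} (ht : t ∈ Icc (0 : ℝ) 1) :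
    ∃ C : ℝ, ∀ᶠ s in 𝓝[Icc 0 1] t, s ∈ Ioo 0 1 \ S → |angSpeed z s| ≤ C := by
  by_cases hz : z t = 0
  · obtain ⟨-, h2, h3⟩ := h.crossing t ht hz
    obtain ⟨C, hC⟩ := eventually_abs_angSpeed_le hz h2 h3
    exact ⟨C, (hC.filter_mono nhdsWithin_le_nhds).mono fun s hs _ => hs⟩
  · have h0 : 0 < ‖z t‖ := norm_pos_iff.2 hz
    refine ⟨M / (‖z t‖ / 2), ?_⟩
    filter_upwards [(h.continuousOn t ht).norm.eventually_const_lt (half_lt_self h0)] with s hs hsS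
    refine (Complex.abs_im_le_norm _).trans ?_
    rw [norm_div]
    have := hM s hsS
    have := (norm_nonneg _).trans this
    gcongr

/-- The angular speed is locally bounded off a finite set, also near the zeros, and the interval is
compact. -/
theorem IsRegularCurve.intervalIntegrable_angSpeed {z : ℝ → ℂ} (h : IsRegularCurve z) :
    IntervalIntegrable (angSpeed z) volume 0 1 := by
  obtain ⟨S, hS, M, hM⟩ := h.exists_finite
  have hnull : volume (S ∪ {0, 1}) = 0 :=
    (hS.union (Set.toFinite {0, 1})).measure_zero volume
  have hmeas : AEStronglyMeasurable (angSpeed z) (volume.restrict (Icc 0 1)) := by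
    have h1 : AEMeasurable z (volume.restrict (Icc 0 1)) :=
      h.continuousOn.aemeasurable measurableSet_Icc
    exact (Complex.measurable_im.comp_aemeasurable
      ((measurable_deriv z).aemeasurable.div h1)).aestronglyMeasurable
  rw [intervalIntegrable_iff_integrableOn_Icc_of_le zero_le_one]
  refine LocallyIntegrableOn.integrableOn_isCompact (fun t ht => ?_) isCompact_Icc
  obtain ⟨C, hC⟩ := h.exists_abs_angSpeed_le (fun t ht => (hM t ht).2.2) ht
  obtain ⟨u, hu, hut⟩ := mem_nhdsWithin_iff_exists_mem_nhds_inter.1 hC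
  obtain ⟨v, hvu, hv, htv⟩ := mem_nhds_iff.1 hu
  refine ⟨v ∩ Icc 0 1, inter_mem (mem_nhdsWithin_of_mem_nhds (hv.mem_nhds htv))
    self_mem_nhdsWithin, hmeas.mono_set inter_subset_right,
    HasFiniteIntegral.restrict_of_bounded (C := C)
      ((measure_mono inter_subset_right).trans_lt measure_Icc_lt_top) ?_⟩
  rw [ae_restrict_iff' (hv.measurableSet.inter measurableSet_Icc)]
  have hae : ∀ᵐ s ∂(volume : Measure ℝ), s ∉ S ∪ {0, 1} := measure_eq_zero_iff_ae_notMem.1 hnull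
  filter_upwards [hae] with s hs hsv
  simp only [mem_union, mem_insert_iff, mem_singleton_iff, not_or] at hs
  exact hut ⟨hvu hsv.1, hsv.2⟩ ⟨⟨lt_of_le_of_ne hsv.2.1 (Ne.symm hs.2.1),
    lt_of_le_of_ne hsv.2.2 hs.2.2⟩, hs.1⟩

/-- A continuous function whose derivative vanishes off a countable set is constant. -/
theorem eq_of_hasDerivAt_zero_off_countable {E : Type*} [NormedAddCommGroup E] [NormedSpace ℝ E]
    [CompleteSpace E] {f : ℝ → E} {a b : ℝ} {S : Set ℝ} (hS : S.Countable)
    (hc : ContinuousOn f (Icc a b)) (hd : ∀ t ∈ Ioo a b \ S, HasDerivAt f 0 t) {t : ℝ}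
    (ht : t ∈ Icc a b) : f t = f a := by
  have h := integral_eq_of_hasDerivAt_off_countable_of_le f (fun _ => 0) ht.1 hS
    (hc.mono (Icc_subset_Icc_right ht.2))
    (fun s hs => hd s ⟨⟨hs.1.1, hs.1.2.trans_le ht.2⟩, hs.2⟩) (by simp)
  rw [intervalIntegral.integral_zero] at h
  exact (sub_eq_zero.1 h.symm)

theorem IsRegularCurve.continuousOn_angle {z : ℝ → ℂ} (h : IsRegularCurve z) :
    ContinuousOn (angle z) (Icc 0 1) := by
  have := intervalIntegral.continuousOn_primitive_interval (f := angSpeed z) (μ := volume)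
    (a := 0) (b := 1) (by
      rw [uIcc_of_le zero_le_one]
      exact (intervalIntegrable_iff_integrableOn_Icc_of_le zero_le_one).1
        h.intervalIntegrable_angSpeed)
  rwa [uIcc_of_le zero_le_one] at this

theorem angle_zero (z : ℝ → ℂ) : angle z 0 = 0 := intervalIntegral.integral_same

theorem IsRegularCurve.exists_finite_hasDerivAt_angle {z : ℝ → ℂ} (h : IsRegularCurve z) :
    ∃ S : Set ℝ, S.Finite ∧ ∀ t ∈ Ioo 0 1 \ S,
      z t ≠ 0 ∧ DifferentiableAt ℝ z t ∧ HasDerivAt (angle z) (angSpeed z t) t := by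
  obtain ⟨S, hS, M, hM⟩ := h.exists_finite
  refine ⟨S ∪ {t ∈ Icc (0 : ℝ) 1 | z t = 0}, hS.union h.finite_zeros, fun t ht => ?_⟩
  have htS : t ∈ Ioo 0 1 \ S := ⟨ht.1, fun h' => ht.2 (Or.inl h')⟩
  have hz : z t ≠ 0 := fun h' => ht.2 (Or.inr ⟨Ioo_subset_Icc_self ht.1, h'⟩)
  refine ⟨hz, (hM t htS).1, ?_⟩
  have hint : IntervalIntegrable (angSpeed z) volume 0 t :=
    h.intervalIntegrable_angSpeed.mono_set (by
      rw [uIcc_of_le ht.1.1.le, uIcc_of_le zero_le_one]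
      exact Icc_subset_Icc_right ht.1.2.le)
  refine intervalIntegral.integral_hasDerivAt_right hint ?_ ?_
  · refine ⟨Ioo 0 1, Ioo_mem_nhds ht.1.1 ht.1.2, ?_⟩
    exact (((intervalIntegrable_iff_integrableOn_Icc_of_le zero_le_one).1
      h.intervalIntegrable_angSpeed).mono_set Ioo_subset_Icc_self).aestronglyMeasurable
  · exact Complex.continuous_im.continuousAt.comp
      ((hM t htS).2.1.div (hM t htS).1.continuousAt hz)

theorem hasDerivAt_cexp_mul_I {f : ℝ → ℝ} {f' t : ℝ} (h : HasDerivAt f f' t) (a : ℂ) :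
    HasDerivAt (fun s => Complex.exp (a * Complex.I * f s))
      (a * Complex.I * f' * Complex.exp (a * Complex.I * f t)) t := by
  have := (h.ofReal_comp.const_mul (a * Complex.I)).cexp
  convert! this using 1
  ring

theorem IsRegularCurve.continuousOn_cexp_angle {z : ℝ → ℂ} (h : IsRegularCurve z) (a : ℂ) :
    ContinuousOn (fun t => Complex.exp (a * Complex.I * angle z t)) (Icc 0 1) :=
  (continuousOn_const.mul
    (Complex.continuous_ofReal.comp_continuousOn h.continuousOn_angle)).cexp

theorem curveSqDir_eventuallyEq {z : ℝ → ℂ} {t : ℝ} (hz : z t ≠ 0) (hc : ContinuousAt z t) :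
    curveSqDir z =ᶠ[𝓝 t] fun s => sqDir (z s) := by
  filter_upwards [hc.eventually_ne hz] with s hs
  rw [curveSqDir, if_neg hs]

theorem hasDerivAt_curveSqDir {z : ℝ → ℂ} {t : ℝ} (hz : z t ≠ 0) (hd : DifferentiableAt ℝ z t) :
    HasDerivAt (curveSqDir z) (2 * Complex.I * angSpeed z t * curveSqDir z t) t := by
  have h1 := curveSqDir_eventuallyEq hz hd.continuousAt
  rw [h1.eq_of_nhds]
  exact (hasDerivAt_sqDir_comp hz hd).congr_of_eventuallyEq h1

/-- The squared direction of a regular curve rotates by twice the swept angle, also across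
passages through the origin. -/
theorem IsRegularCurve.curveSqDir_eq {z : ℝ → ℂ} (h : IsRegularCurve z) {t : ℝ}
    (ht : t ∈ Icc (0 : ℝ) 1) :
    curveSqDir z t = Complex.exp (2 * Complex.I * angle z t) * curveSqDir z 0 := by
  obtain ⟨S, hS, hS'⟩ := h.exists_finite_hasDerivAt_angle
  -- The counter-rotated squared direction is continuous everywhere and stationary off the
  -- breakpoints and zeros, hence constant.
  have hconst := eq_of_hasDerivAt_zero_off_countable
    (f := fun t => Complex.exp (-2 * Complex.I * angle z t) * curveSqDir z t) hS.countable
    ((h.continuousOn_cexp_angle (-2)).mul h.continuousOn_curveSqDir) (fun s hs => by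
      obtain ⟨hz, hd, ha⟩ := hS' s hs
      have h1 := (hasDerivAt_cexp_mul_I ha (-2)).mul (hasDerivAt_curveSqDir hz hd)
      convert! h1 using 1
      ring) ht
  simp only [angle_zero, Complex.ofReal_zero, mul_zero, Complex.exp_zero, one_mul] at hconst
  rw [← hconst, ← mul_assoc, ← Complex.exp_add]
  ring_nf
  simp

/-- The swept angle is differentiable wherever the curve is differentiable and off the origin. -/
theorem IsRegularCurve.hasDerivAt_angle {z : ℝ → ℂ} (h : IsRegularCurve z) {t : ℝ}
    (ht : t ∈ Ioo (0 : ℝ) 1) (hz : z t ≠ 0) (hd : DifferentiableAt ℝ z t) :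
    HasDerivAt (angle z) (angSpeed z t) t := by
  have hc : ContinuousAt (angle z) t :=
    h.continuousOn_angle.continuousAt (Icc_mem_nhds ht.1 ht.2)
  have hu : curveSqDir z t ≠ 0 :=
    norm_ne_zero_iff.1 (by rw [norm_curveSqDir h (Ioo_subset_Icc_self ht)]; exact one_ne_zero)
  -- At the finitely many exceptional times the velocity is not known to be continuous, so the
  -- fundamental theorem of calculus does not apply. The angle is recovered instead as half the
  -- argument of the squared direction, which is differentiable wherever `z` is.
  have hev : angle z =ᶠ[𝓝 t] fun s =>
      (Complex.log (curveSqDir z s / curveSqDir z t)).im / 2 + angle z t := by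
    have h1 : ∀ᶠ s in 𝓝 t, angle z s - angle z t ∈ Ioo (-(Real.pi / 2)) (Real.pi / 2) := by
      have : ContinuousAt (fun s => angle z s - angle z t) t := hc.sub continuousAt_const
      refine this.eventually (Ioo_mem_nhds ?_ ?_) <;> simp [Real.pi_pos]
    filter_upwards [h1, Icc_mem_nhds ht.1 ht.2] with s hs hs1
    have h2 : curveSqDir z s / curveSqDir z t =
        Complex.exp ((2 * (angle z s - angle z t) : ℝ) * Complex.I) := by
      rw [div_eq_iff hu, h.curveSqDir_eq hs1, h.curveSqDir_eq (Ioo_subset_Icc_self ht),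
        ← mul_assoc, ← Complex.exp_add]
      congr 2
      push_cast
      ring
    rw [h2, Complex.log_exp] <;> simp <;> linarith [hs.1, hs.2]
  have hq : HasDerivAt (fun s => curveSqDir z s / curveSqDir z t)
      (2 * Complex.I * angSpeed z t) t := by
    have := (hasDerivAt_curveSqDir hz hd).div_const (curveSqDir z t)
    rwa [mul_div_cancel_right₀ _ hu] at this
  have hlog := hq.clog_real (by rw [div_self hu]; exact Complex.one_mem_slitPlane)
  rw [div_self hu, div_one] at hlog
  have him : HasDerivAt (fun s => (Complex.log (curveSqDir z s / curveSqDir z t)).im)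
      (2 * Complex.I * angSpeed z t).im t :=
    Complex.imCLM.hasFDerivAt.comp_hasDerivAt t hlog
  refine HasDerivAt.congr_of_eventuallyEq ?_ hev
  convert! (him.div_const 2).add_const (angle z t) using 1
  simp

/-- A closed regular curve sweeps an angle in `π ℤ`. -/
theorem IsRegularCurve.exists_angle_eq {z : ℝ → ℂ} (h : IsRegularCurve z) (h0 : z 0 ≠ 0)
    (h1 : z 1 = z 0) : ∃ k : ℤ, angle z 1 = k * Real.pi := by
  have h2 := h.curveSqDir_eq (right_mem_Icc.2 zero_le_one)
  have hu : curveSqDir z 0 ≠ 0 :=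
    norm_ne_zero_iff.1 (by
      rw [norm_curveSqDir h (left_mem_Icc.2 zero_le_one)]; exact one_ne_zero)
  have h3 : curveSqDir z 1 = curveSqDir z 0 := by
    rw [curveSqDir, curveSqDir, if_neg h0, if_neg (h1 ▸ h0), h1]
  rw [h3] at h2
  have h4 := mul_right_cancel₀ hu (h2.symm.trans (one_mul _).symm)
  obtain ⟨k, hk⟩ := Complex.exp_eq_one_iff.1 h4
  refine ⟨k, ?_⟩
  have h5 : ((angle z 1 : ℝ) : ℂ) = ((k * Real.pi : ℝ) : ℂ) := by
    push_cast
    have : (2 * Complex.I) ≠ 0 := by simp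
    apply mul_left_cancel₀ this
    rw [hk]
    ring
  exact_mod_cast h5

/-- A closed regular curve avoiding the origin sweeps an angle in `2π ℤ`. -/
theorem IsRegularCurve.exists_angle_eq_of_ne_zero {z : ℝ → ℂ} (h : IsRegularCurve z)
    (h0 : ∀ t ∈ Icc (0 : ℝ) 1, z t ≠ 0) (h1 : z 1 = z 0) :
    ∃ k : ℤ, angle z 1 = k * (2 * Real.pi) := by
  have hz0 := h0 0 (left_mem_Icc.2 zero_le_one)
  -- The squared direction determines `exp (i A)` only up to sign. Here `f` is real, continuous,
  -- nowhere zero and `1` at the start, so it stays positive; at the end it is `exp (-i A)`, which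
  -- must then be `1`.
  set f : ℝ → ℂ := fun t => Complex.exp (-1 * Complex.I * angle z t) * z t / z 0 with hf
  have hfc : ContinuousOn f (Icc 0 1) :=
    ((h.continuousOn_cexp_angle (-1)).mul h.continuousOn).div_const _
  have hf0 : f 0 = 1 := by simp [hf, angle_zero, hz0]
  have hfne : ∀ t ∈ Icc (0 : ℝ) 1, f t ≠ 0 := fun t ht =>
    div_ne_zero (mul_ne_zero (Complex.exp_ne_zero _) (h0 t ht)) hz0
  have hreal : ∀ t ∈ Icc (0 : ℝ) 1, (starRingEnd ℂ) (f t) = f t := by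
    intro t ht
    have h2 := h.curveSqDir_eq ht
    rw [curveSqDir, curveSqDir, if_neg hz0, if_neg (h0 t ht), sqDir, sqDir] at h2
    have hc0 : (starRingEnd ℂ) (z 0) ≠ 0 := (map_ne_zero _).2 hz0
    have hct : (starRingEnd ℂ) (z t) ≠ 0 := (map_ne_zero _).2 (h0 t ht)
    have he : Complex.exp (2 * Complex.I * angle z t) =
        Complex.exp (Complex.I * angle z t) * Complex.exp (Complex.I * angle z t) := by
      rw [← Complex.exp_add]
      ring_nf
    have he' : Complex.exp (-1 * Complex.I * angle z t) =
        (Complex.exp (Complex.I * angle z t))⁻¹ := by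
      rw [← Complex.exp_neg]
      ring_nf
    have hne := Complex.exp_ne_zero (Complex.I * angle z t)
    have hec : (starRingEnd ℂ) (Complex.exp (-1 * Complex.I * angle z t)) =
        Complex.exp (Complex.I * angle z t) := by
      rw [← Complex.exp_conj]
      simp
    simp only [hf, map_div₀, map_mul, hec]
    rw [he] at h2
    rw [he']
    field_simp at h2 ⊢
    linear_combination -h2
  have hpos : 0 < (f 1).re := by
    by_contra hneg
    have hcr : ContinuousOn (fun t => (f t).re) (Icc 0 1) :=
      Complex.continuous_re.comp_continuousOn hfc
    obtain ⟨t, ht, ht0⟩ := intermediate_value_Icc' zero_le_one hcr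
      (show (0 : ℝ) ∈ Icc _ _ from ⟨not_lt.1 hneg, by rw [hf0]; simp⟩)
    apply hfne t ht
    apply Complex.ext ht0
    exact Complex.conj_eq_iff_im.1 (hreal t ht)
  have hf1 : f 1 = Complex.exp ((-angle z 1 : ℝ) * Complex.I) := by
    simp only [hf, h1]
    rw [mul_div_cancel_right₀ _ hz0]
    congr 1
    push_cast
    ring
  have him := Complex.conj_eq_iff_im.1 (hreal 1 (right_mem_Icc.2 zero_le_one))
  rw [hf1, Complex.exp_ofReal_mul_I_im] at him
  rw [hf1, Complex.exp_ofReal_mul_I_re] at hpos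
  have hcos : Real.cos (angle z 1) = 1 := by
    rw [Real.sin_neg, neg_eq_zero] at him
    rw [Real.cos_neg] at hpos
    nlinarith [Real.sin_sq_add_cos_sq (angle z 1)]
  obtain ⟨k, hk⟩ := (Real.cos_eq_one_iff _).1 hcos
  exact ⟨k, hk.symm⟩

/-! ### Chords of simple closed curves -/

/-- The chord `z (s + x) - z s` of a closed curve of period `1`, divided by `x (1 - x)`, in a form
that makes sense for all `s` and `x`. -/
def chordQuotient (z : ℝ → ℂ) (s x : ℝ) : ℂ :=
  (∫ y in (0 : ℝ)..1, deriv z (s + y • x)) - ∫ y in (0 : ℝ)..1, deriv z (s + 1 + y • (x - 1))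

theorem mul_integral_deriv_eq_sub {z : ℝ → ℂ} (hz : ContDiff ℝ 1 z) (s x : ℝ) :
    (x : ℂ) * ∫ y in (0 : ℝ)..1, deriv z (s + y • x) = z (s + x) - z s := by
  have hc : Continuous (deriv z) := hz.continuous_deriv le_rfl
  have h := intervalIntegral.integral_unitInterval_deriv_eq_sub (f := z) (f' := deriv z)
    (z₀ := s) (z₁ := x) (hc.comp (by fun_prop)).continuousOn
    (fun t _ => (hz.differentiable one_ne_zero _).hasDerivAt)
  rw [← h, Complex.real_smul]

/-- The chord is `x` times the first integral (forwards from `s`) and, by periodicity, `x - 1` times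
the second (backwards from `s + 1`). Weighting these two identities by `1 - x` and `x` gives the
claim. -/
theorem mul_chordQuotient {z : ℝ → ℂ} (hz : ContDiff ℝ 1 z) (hp : Function.Periodic z 1)
    (s x : ℝ) : (x * (1 - x) : ℂ) * chordQuotient z s x = z (s + x) - z s := by
  have h1 := mul_integral_deriv_eq_sub hz s x
  have h2 := mul_integral_deriv_eq_sub hz (s + 1) (x - 1)
  rw [show s + 1 + (x - 1) = s + x by ring, hp s] at h2
  push_cast at h2
  rw [chordQuotient]
  linear_combination (1 - x : ℂ) * h1 + x * h2

theorem continuous_chordQuotient {z : ℝ → ℂ} (hz : ContDiff ℝ 1 z) :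
    Continuous fun q : ℝ × ℝ => chordQuotient z q.1 q.2 := by
  have hc : Continuous (deriv z) := hz.continuous_deriv le_rfl
  refine Continuous.sub ?_ ?_
  · exact intervalIntegral.continuous_parametric_intervalIntegral_of_continuous'
      (f := fun (q : ℝ × ℝ) y => deriv z (q.1 + y • q.2)) (hc.comp (by fun_prop)) 0 1
  · exact intervalIntegral.continuous_parametric_intervalIntegral_of_continuous'
      (f := fun (q : ℝ × ℝ) y => deriv z (q.1 + 1 + y • (q.2 - 1))) (hc.comp (by fun_prop)) 0 1

/-- The second integral runs over a full period and vanishes. At `x = 1` it is the first that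
vanishes, so the two end values are opposite tangent vectors. -/
theorem chordQuotient_zero {z : ℝ → ℂ} (hz : ContDiff ℝ 1 z) (hp : Function.Periodic z 1)
    (s : ℝ) : chordQuotient z s 0 = deriv z s := by
  have h2 := mul_integral_deriv_eq_sub hz (s + 1) (-1)
  rw [show s + 1 + -1 = s by ring, hp s, sub_self] at h2
  have h3 : ∫ y in (0 : ℝ)..1, deriv z (s + 1 + y • (0 - 1)) = 0 := by simpa using h2
  rw [chordQuotient, h3]
  simp

theorem chordQuotient_one {z : ℝ → ℂ} (hz : ContDiff ℝ 1 z) (hp : Function.Periodic z 1)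
    (s : ℝ) : chordQuotient z s 1 = -deriv z s := by
  have h2 := mul_integral_deriv_eq_sub hz s 1
  rw [hp s, sub_self, Complex.ofReal_one, one_mul] at h2
  have h3 : deriv z (s + 1) = deriv z s := by
    rw [← deriv_comp_add_const, hp.funext]
  rw [chordQuotient, h2]
  simp [h3]

theorem exists_int_sub_eq {α : Type*} {f : ℝ → α} (hp : Function.Periodic f 1)
    (hinj : InjOn f (Ico 0 1)) {s t : ℝ} (h : f s = f t) : ∃ k : ℤ, s - t = k := by
  have hfr : ∀ t : ℝ, f (Int.fract t) = f t := fun t => by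
    have := hp.sub_int_mul_eq (x := t) ⌊t⌋
    rwa [mul_one] at this
  exact Int.fract_eq_fract.1 (hinj ⟨Int.fract_nonneg _, Int.fract_lt_one _⟩
    ⟨Int.fract_nonneg _, Int.fract_lt_one _⟩ ((hfr s).trans (h.trans (hfr t).symm)))

/-- Injectivity handles `0 < x < 1`, and nonzero velocity the two ends. -/
theorem chordQuotient_ne_zero {z : ℝ → ℂ} (hz : ContDiff ℝ 1 z) (hp : Function.Periodic z 1)
    (hreg : ∀ t, deriv z t ≠ 0) (hinj : InjOn z (Ico 0 1)) (s : ℝ) {x : ℝ}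
    (hx : x ∈ Icc (0 : ℝ) 1) : chordQuotient z s x ≠ 0 := by
  rcases eq_or_lt_of_le hx.1 with rfl | h0
  · rw [chordQuotient_zero hz hp]; exact hreg s
  rcases eq_or_lt_of_le hx.2 with rfl | h1
  · rw [chordQuotient_one hz hp]; exact neg_ne_zero.2 (hreg s)
  intro h
  have h2 := mul_chordQuotient hz hp s x
  rw [h, mul_zero, eq_comm, sub_eq_zero] at h2
  obtain ⟨k, hk⟩ := exists_int_sub_eq hp hinj h2
  rw [add_sub_cancel_left] at hk
  rw [hk] at h0 h1
  have h0' : 0 < k := by exact_mod_cast h0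
  have h1' : k < 1 := by exact_mod_cast h1
  omega

/-- A continuous logarithm of a differentiable function is differentiable. -/
theorem hasDerivAt_of_cexp {l f : ℝ → ℂ} {f' : ℂ} {t : ℝ} (hl : ContinuousAt l t)
    (hf : HasDerivAt f f' t) (he : ∀ᶠ s in 𝓝 t, Complex.exp (l s) = f s) :
    HasDerivAt l (f' / f t) t := by
  have ht := he.self_of_nhds
  have hft : f t ≠ 0 := ht ▸ Complex.exp_ne_zero _
  have hev : l =ᶠ[𝓝 t] fun s => Complex.log (f s / f t) + l t := by
    have h1 : ∀ᶠ s in 𝓝 t, (l s - l t).im ∈ Ioo (-Real.pi) Real.pi := by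
      have : ContinuousAt (fun s => (l s - l t).im) t :=
        Complex.continuous_im.continuousAt.comp (hl.sub continuousAt_const)
      refine this.eventually (Ioo_mem_nhds ?_ ?_) <;> simp [Real.pi_pos]
    filter_upwards [h1, he] with s hs hes
    rw [← hes, ← ht, ← Complex.exp_sub, Complex.log_exp hs.1 hs.2.le, sub_add_cancel]
  refine HasDerivAt.congr_of_eventuallyEq ?_ hev
  have h2 := (hf.div_const (f t)).clog_real (by
    rw [div_self hft]; exact Complex.one_mem_slitPlane)
  rw [div_self hft, div_one] at h2
  exact h2.add_const _

/-- A continuous angle along a path in the closed upper half plane whose end points are opposite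
real directions changes by `± π`. -/
theorem sub_eq_pi_or_neg_pi_of_sin_nonneg {f : ℝ → ℝ} (hf : ContinuousOn f (Icc 0 1))
    (hsin : ∀ x ∈ Icc (0 : ℝ) 1, 0 ≤ Real.sin (f x)) (h0 : Real.sin (f 0) = 0) {k : ℤ}
    (hk : f 1 - f 0 = (2 * k + 1) * Real.pi) : f 1 - f 0 = Real.pi ∨ f 1 - f 0 = -Real.pi := by
  obtain ⟨m, hm⟩ := Real.sin_eq_zero_iff.1 h0
  have hpi := Real.pi_pos
  -- At two consecutive odd multiples of `π / 2` the sine takes the values `1` and `-1`, so `f`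
  -- cannot pass through both. Starting from `m π`, a change of `3 π` or more in either direction
  -- would force this.
  have key : ∀ j : ℤ, ¬ (((j : ℝ) * Real.pi + Real.pi / 2 ∈ uIcc (f 0) (f 1)) ∧
      (((j + 1 : ℤ) : ℝ) * Real.pi + Real.pi / 2 ∈ uIcc (f 0) (f 1))) := by
    rintro j ⟨h1, h2⟩
    have hiv := intermediate_value_uIcc (a := (0 : ℝ)) (b := 1) (f := f)
      (by rwa [uIcc_of_le zero_le_one])
    rw [uIcc_of_le (zero_le_one' ℝ)] at hiv
    obtain ⟨x, hx, hfx⟩ := hiv h1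
    obtain ⟨y, hy, hfy⟩ := hiv h2
    have hsx := hsin x hx
    have hsy := hsin y hy
    rw [hfx, Real.sin_add_pi_div_two] at hsx
    rw [hfy, Real.sin_add_pi_div_two] at hsy
    rw [Int.cast_add, Int.cast_one, add_mul, one_mul, Real.cos_add_pi] at hsy
    have hs : Real.sin (j * Real.pi) = 0 := Real.sin_int_mul_pi j
    nlinarith [Real.sin_sq_add_cos_sq (j * Real.pi)]
  have hk1 : k < 1 := by
    by_contra hcon
    have hcon' : (1 : ℝ) ≤ k := by exact_mod_cast not_lt.1 hcon
    apply key m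
    rw [uIcc_of_le (by nlinarith)]
    push_cast
    refine ⟨⟨?_, ?_⟩, ?_, ?_⟩ <;> nlinarith
  have hk2 : -2 < k := by
    by_contra hcon
    have hcon' : (k : ℝ) ≤ -2 := by exact_mod_cast not_lt.1 hcon
    apply key (m - 2)
    rw [uIcc_of_ge (by nlinarith)]
    push_cast
    refine ⟨⟨?_, ?_⟩, ?_, ?_⟩ <;> nlinarith
  have hk3 : k = 0 ∨ k = -1 := by omega
  rcases hk3 with rfl | rfl
  · left; rw [hk]; simp
  · right; rw [hk]; push_cast; ring

/-- As in Hopf's proof of the theorem on turning tangents: the chords of a simple closed curve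
from any of its points turn by the angle `± π`. -/
theorem exists_chord_logarithm {z : ℝ → ℂ} (hz : ContDiff ℝ 1 z) (hp : Function.Periodic z 1)
    (hreg : ∀ t, deriv z t ≠ 0) (hinj : InjOn z (Ico 0 1)) (s : ℝ) :
    ∃ l : ℝ → ℂ, Continuous l ∧
      (∀ x ∈ Icc (0 : ℝ) 1, Complex.exp (l x) = chordQuotient z s x) ∧
      ((l 1).im - (l 0).im = Real.pi ∨ (l 1).im - (l 0).im = -Real.pi) := by
  -- Clamping `x` to `[0, 1]` makes the quotient nonvanishing on the whole simply connected plane,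
  -- so it lifts through the exponential.
  let F : C(ℝ × ℝ, ℂ) := ⟨fun q => chordQuotient z q.1 (projIcc (0 : ℝ) 1 zero_le_one q.2),
    (continuous_chordQuotient hz).comp (g := fun q : ℝ × ℝ => chordQuotient z q.1 q.2)
      (f := fun q : ℝ × ℝ => (q.1, (projIcc (0 : ℝ) 1 zero_le_one q.2 : ℝ)))
      (continuous_fst.prodMk
        (continuous_subtype_val.comp (continuous_projIcc.comp continuous_snd)))⟩
  have hF : ∀ q, F q ∈ ({0}ᶜ : Set ℂ) := fun q =>
    chordQuotient_ne_zero hz hp hreg hinj _ (projIcc (0 : ℝ) 1 zero_le_one q.2).2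
  have hFx : ∀ r, ∀ x ∈ Icc (0 : ℝ) 1, F (r, x) = chordQuotient z r x := by
    intro r x hx
    change chordQuotient z r (projIcc (0 : ℝ) 1 zero_le_one x) = _
    rw [projIcc_of_mem zero_le_one hx]
  obtain ⟨l, ⟨-, hl⟩, -⟩ := Complex.isCoveringMapOn_exp.existsUnique_continuousMap_lifts F
    (a₀ := (0, 0)) (e₀ := Complex.log (F (0, 0))) (Complex.exp_log (hF _)) hF
  have hexp : ∀ r, ∀ x ∈ Icc (0 : ℝ) 1, Complex.exp (l (r, x)) = chordQuotient z r x := by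
    intro r x hx
    rw [← hFx r x hx, ← hl, Function.comp_apply]
  have h0 : (0 : ℝ) ∈ Icc (0 : ℝ) 1 := left_mem_Icc.2 zero_le_one
  have h1 : (1 : ℝ) ∈ Icc (0 : ℝ) 1 := right_mem_Icc.2 zero_le_one
  set L : ℝ → ℝ := fun r => (l (r, 1)).im - (l (r, 0)).im with hL
  have hLc : Continuous L := by
    have := l.continuous
    exact (Complex.continuous_im.comp (this.comp (by fun_prop))).sub
      (Complex.continuous_im.comp (this.comp (by fun_prop)))
  have hodd : ∀ r, ∃ k : ℤ, L r = (2 * k + 1) * Real.pi := by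
    intro r
    have h2 : Complex.exp (l (r, 1) - l (r, 0) + Real.pi * Complex.I) = 1 := by
      rw [Complex.exp_add, Complex.exp_pi_mul_I, Complex.exp_sub, hexp r 1 h1, hexp r 0 h0,
        chordQuotient_one hz hp, chordQuotient_zero hz hp, neg_div, div_self (hreg r)]
      norm_num
    obtain ⟨k, hk⟩ := Complex.exp_eq_one_iff.1 h2
    refine ⟨k - 1, ?_⟩
    have h3 := congrArg Complex.im hk
    simp at h3
    simp only [hL]
    push_cast
    linarith
  -- The total turning is continuous in the base point with values in the odd multiples of `π`,
  -- hence it may be computed at any convenient point.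
  have hconst : ∀ r r', L r = L r' := by
    intro r r'
    have hc : Continuous fun r => L r / (2 * Real.pi) - 1 / 2 := by fun_prop
    have hr : ∀ r, ∃ k : ℤ, L r / (2 * Real.pi) - 1 / 2 = k := by
      intro r
      obtain ⟨k, hk⟩ := hodd r
      refine ⟨k, ?_⟩
      rw [hk]
      field_simp
      ring
    choose g hg using hr
    have hgc : Continuous g :=
      Int.isClosedEmbedding_coe_real.isEmbedding.continuous_iff.2 (hc.congr hg)
    have h4 := PreconnectedSpace.constant inferInstance hgc (x := r) (y := r')
    have h5 := hg r
    rw [h4, ← hg r'] at h5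
    have := Real.pi_pos
    field_simp at h5
    linarith
  -- At a lowest point the tangent is horizontal and all chords point into the closed upper half
  -- plane.
  obtain ⟨m, -, hm⟩ := isCompact_Icc.exists_isMinOn (nonempty_Icc.2 (zero_le_one' ℝ))
    (Complex.continuous_im.comp hz.continuous).continuousOn
  have hmin : ∀ t, (z m).im ≤ (z t).im := by
    intro t
    have h2 := hp.sub_int_mul_eq (x := t) ⌊t⌋
    rw [mul_one] at h2
    rw [← h2]
    exact hm ⟨Int.fract_nonneg t, (Int.fract_lt_one t).le⟩
  have hdm : (deriv z m).im = 0 := by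
    have hd : HasDerivAt (fun t => (z t).im) (deriv z m).im m :=
      Complex.imCLM.hasFDerivAt.comp_hasDerivAt m (hz.differentiable one_ne_zero m).hasDerivAt
    exact IsLocalMin.hasDerivAt_eq_zero (Eventually.of_forall hmin) hd
  have hsin : ∀ x ∈ Icc (0 : ℝ) 1, 0 ≤ Real.sin (l (m, x)).im := by
    intro x hx
    have h2 : 0 ≤ (chordQuotient z m x).im := by
      rcases eq_or_lt_of_le hx.1 with rfl | hx0
      · rw [chordQuotient_zero hz hp, hdm]
      rcases eq_or_lt_of_le hx.2 with rfl | hx1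
      · rw [chordQuotient_one hz hp, Complex.neg_im, hdm, neg_zero]
      have h3 := congrArg Complex.im (mul_chordQuotient hz hp m x)
      rw [show (x * (1 - x) : ℂ) = ((x * (1 - x) : ℝ) : ℂ) by push_cast; ring,
        Complex.im_ofReal_mul, Complex.sub_im] at h3
      have h4 : 0 < x * (1 - x) := mul_pos hx0 (sub_pos.2 hx1)
      have h5 := hmin (m + x)
      by_contra hcon
      nlinarith
    rw [← hexp m x hx, Complex.exp_im] at h2
    exact nonneg_of_mul_nonneg_right h2 (Real.exp_pos _)
  have hsin0 : Real.sin (l (m, 0)).im = 0 := by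
    have h2 := congrArg Complex.im (hexp m 0 h0)
    rw [chordQuotient_zero hz hp, hdm, Complex.exp_im] at h2
    exact (mul_eq_zero.1 h2).resolve_left (Real.exp_ne_zero _)
  refine ⟨fun x => l (s, x), l.continuous.comp (by fun_prop), hexp s, ?_⟩
  obtain ⟨k, hk⟩ := hodd m
  have h6 := sub_eq_pi_or_neg_pi_of_sin_nonneg (f := fun x => (l (m, x)).im)
    (Complex.continuous_im.comp (l.continuous.comp (by fun_prop))).continuousOn hsin hsin0 hk
  change L s = _ ∨ L s = _
  rw [hconst s m]
  exact h6

/-- A smooth simple closed curve sweeps the angle `± π` as seen from one of its points. -/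
theorem integral_angSpeed_of_simple_closed {z : ℝ → ℂ} (hz : ContDiff ℝ 1 z)
    (hp : Function.Periodic z 1) (hreg : ∀ t, deriv z t ≠ 0) (hinj : InjOn z (Ico 0 1)) {s : ℝ}
    (hs : z s = 0) (hint : IntervalIntegrable (angSpeed z) volume s (s + 1)) :
    ∫ t in s..s + 1, angSpeed z t = Real.pi ∨ ∫ t in s..s + 1, angSpeed z t = -Real.pi := by
  obtain ⟨l, hlc, hexp, hl⟩ := exists_chord_logarithm hz hp hreg hinj s
  have hcont : Continuous fun t => (l (t - s)).im :=
    Complex.continuous_im.comp (hlc.comp (by fun_prop))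
  -- As `z s = 0`, the chord is `z` itself, and it differs from its quotient by the positive factor
  -- `x (1 - x)`. So `Im l` is a primitive of the angular speed.
  have h := integral_eq_of_hasDerivAt_off_countable_of_le (fun t => (l (t - s)).im) (angSpeed z)
    (by linarith : s ≤ s + 1) countable_empty hcont.continuousOn (fun t ht => ?_) hint
  · rw [add_sub_cancel_left, sub_self] at h
    rwa [h]
  have ht0 : 0 < t - s := sub_pos.2 ht.1.1
  have ht1 : t - s < 1 := by linarith [ht.1.2]
  have hne : ((t - s : ℝ) * (1 - (t - s : ℝ)) : ℂ) ≠ 0 := by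
    exact_mod_cast (mul_pos ht0 (sub_pos.2 ht1)).ne'
  have hev : ∀ᶠ r in 𝓝 t, Complex.exp (l (r - s)) =
      (((r - s) * (1 - (r - s)))⁻¹ : ℝ) * z r := by
    filter_upwards [Ioo_mem_nhds ht.1.1 ht.1.2] with r hr
    have hr0 : 0 < r - s := sub_pos.2 hr.1
    have hr1 : r - s < 1 := by linarith [hr.2]
    rw [hexp (r - s) ⟨hr0.le, hr1.le⟩]
    have h1 := mul_chordQuotient hz hp s (r - s)
    rw [add_sub_cancel, hs, sub_zero] at h1
    have hne : ((r - s : ℝ) * (1 - (r - s : ℝ)) : ℂ) ≠ 0 := by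
      exact_mod_cast (mul_pos hr0 (sub_pos.2 hr1)).ne'
    rw [← h1]
    push_cast at hne ⊢
    obtain ⟨ha, hb⟩ := mul_ne_zero_iff.1 hne
    field_simp
  have hw : HasDerivAt (fun r : ℝ => ((r - s) * (1 - (r - s)))⁻¹)
      (-(1 - 2 * (t - s)) / ((t - s) * (1 - (t - s))) ^ 2) t := by
    have h1 : HasDerivAt (fun r : ℝ => (r - s) * (1 - (r - s))) (1 - 2 * (t - s)) t := by
      have h2 := (hasDerivAt_id t).sub_const s
      convert! h2.mul (h2.const_sub 1) using 1
      simp; ring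
    exact h1.inv (mul_pos ht0 (sub_pos.2 ht1)).ne'
  have hd := hasDerivAt_of_cexp (hlc.comp (by fun_prop : Continuous fun r => r - s)).continuousAt
    (hw.ofReal_comp.mul (hz.differentiable one_ne_zero t).hasDerivAt) hev
  have hd' : HasDerivAt (fun r => (l (r - s)).im) _ t :=
    Complex.imCLM.hasFDerivAt.comp_hasDerivAt t hd
  convert! hd' using 1
  have hzt : z t ≠ 0 := by
    intro h0
    have := hev.self_of_nhds
    rw [h0, mul_zero] at this
    exact Complex.exp_ne_zero _ this
  -- The last summand is the logarithmic derivative of `x (1 - x)`; it is real and drops out of the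
  -- imaginary part.
  have hrew : (deriv z t / z t) = (((-(1 - 2 * (t - s)) / ((t - s) * (1 - (t - s))) ^ 2 : ℝ) : ℂ) *
      z t + (((t - s) * (1 - (t - s)))⁻¹ : ℝ) * deriv z t) /
      ((((t - s) * (1 - (t - s)))⁻¹ : ℝ) * z t) +
      (((1 - 2 * (t - s)) / ((t - s) * (1 - (t - s))) : ℝ) : ℂ) := by
    push_cast at hne ⊢
    obtain ⟨ha, hb⟩ := mul_ne_zero_iff.1 hne
    field_simp
    ring
  rw [angSpeed, hrew, Complex.add_im, Complex.ofReal_im, add_zero]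
  rfl

/-! ### Curves in the complex coordinate -/

/-- The identification of the coordinate plane with `ℂ`. -/
def toComplex : Plane ≃L[ℝ] ℂ :=
  LinearEquiv.toContinuousLinearEquiv
    { toFun := fun q => ⟨q 0, q 1⟩
      invFun := fun w => ![w.re, w.im]
      map_add' := fun _ _ => rfl
      map_smul' := fun a q => by apply Complex.ext <;> simp
      left_inv := fun q => by ext i; fin_cases i <;> rfl
      right_inv := fun _ => rfl }

@[simp] theorem toComplex_re (q : Plane) : (toComplex q).re = q 0 := rfl

@[simp] theorem toComplex_im (q : Plane) : (toComplex q).im = q 1 := rfl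

/-- The complex coordinate of a curve. -/
def complexCurve (c : ℝ → SymTraceless) (t : ℝ) : ℂ := toComplex (coords c t)

theorem coords_eq_zero {c : ℝ → SymTraceless} {t : ℝ} : coords c t = 0 ↔ c t = 0 :=
  chart.map_eq_zero_iff

theorem complexCurve_eq_zero {c : ℝ → SymTraceless} {t : ℝ} : complexCurve c t = 0 ↔ c t = 0 :=
  toComplex.map_eq_zero_iff.trans coords_eq_zero

theorem complexCurve_eq_iff {c d : ℝ → SymTraceless} {s t : ℝ} :
    complexCurve c s = complexCurve d t ↔ c s = d t :=
  toComplex.injective.eq_iff.trans chart.injective.eq_iff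

theorem differentiableAt_complexCurve {c : ℝ → SymTraceless} {t : ℝ} :
    DifferentiableAt ℝ (complexCurve c) t ↔ DifferentiableAt ℝ (coords c) t :=
  toComplex.comp_differentiableAt_iff

theorem deriv_complexCurve (c : ℝ → SymTraceless) (t : ℝ) :
    deriv (complexCurve c) t = toComplex (velocity c t) := by
  have h := toComplex.comp_fderiv (f := coords c) (x := t)
  have h' := congrArg (fun L : ℝ →L[ℝ] ℂ => L 1) h
  exact h'

theorem contDiffOn_complexCurve {c : ℝ → SymTraceless} {n : WithTop ℕ∞} {s : Set ℝ}
    (h : ContDiffOn ℝ n (coords c) s) : ContDiffOn ℝ n (complexCurve c) s :=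
  toComplex.contDiff.comp_contDiffOn h

theorem angularForm_eq_im (q X : Plane) :
    angularForm q X = (toComplex X / toComplex q).im := by
  rw [angularForm, Complex.div_im, Complex.normSq_apply]
  simp only [toComplex_re, toComplex_im]
  ring

theorem angularSpeed_eq (c : ℝ → SymTraceless) (t : ℝ) :
    angularSpeed c t = angSpeed (complexCurve c) t := by
  rw [angularSpeed, angularForm_eq_im, angSpeed, deriv_complexCurve]
  rfl

theorem exists_mem_Ioc_of_strictMono {n : ℕ} {τ : Fin (n + 1) → ℝ} {t : ℝ} (h0 : τ 0 < t)
    (h1 : t ≤ τ (Fin.last n)) : ∃ i : Fin n, t ∈ Ioc (τ i.castSucc) (τ i.succ) := by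
  have key : ∀ j : Fin (n + 1), t ≤ τ j → ∃ i : Fin n, t ∈ Ioc (τ i.castSucc) (τ i.succ) := by
    intro j
    induction j using Fin.induction with
    | zero => exact fun h => absurd h (not_le.2 h0)
    | succ i ih =>
      intro h
      by_cases hi : t ≤ τ i.castSucc
      · exact ih hi
      · exact ⟨i, not_le.1 hi, h⟩
  exact key _ h1

theorem IsPiecewiseSmooth.continuousOn {c : ℝ → SymTraceless} (h : IsPiecewiseSmooth c) :
    ContinuousOn (complexCurve c) (Icc 0 1) := by
  obtain ⟨n, τ, hτ, h0, h1, hs⟩ := h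
  have hU : ContinuousOn (complexCurve c) (⋃ i : Fin n, Icc (τ i.castSucc) (τ i.succ)) :=
    (locallyFinite_of_finite _).continuousOn_iUnion (fun _ => isClosed_Icc)
      (fun i => (contDiffOn_complexCurve (hs i)).continuousOn)
  refine hU.mono fun t ht => mem_iUnion.2 ?_
  rcases eq_or_lt_of_le ht.1 with rfl | h
  · have hn : 0 < n := by
      rcases Nat.eq_zero_or_pos n with rfl | hn
      · rw [show Fin.last 0 = 0 from rfl, h0] at h1
        norm_num at h1
      · exact hn
    refine ⟨⟨0, hn⟩, ?_⟩
    have h2 : (⟨0, hn⟩ : Fin n).castSucc = 0 := rfl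
    have h3 := hτ (Fin.castSucc_lt_succ (i := (⟨0, hn⟩ : Fin n)))
    rw [h2, h0] at h3
    rw [h2, h0]
    exact ⟨le_rfl, h3.le⟩
  · obtain ⟨i, hi⟩ := exists_mem_Ioc_of_strictMono (h0.symm ▸ h) (h1.symm ▸ ht.2)
    exact ⟨i, Ioc_subset_Icc_self hi⟩

/-- On each compact piece the derivative within the piece is continuous, hence bounded, and in the
interior it is the ordinary one. The breakpoints are the exceptional set. -/
theorem IsPiecewiseSmooth.exists_finite {c : ℝ → SymTraceless} (h : IsPiecewiseSmooth c) :
    ∃ S : Set ℝ, S.Finite ∧ ∃ M : ℝ, ∀ t ∈ Ioo 0 1 \ S,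
      DifferentiableAt ℝ (complexCurve c) t ∧ ContinuousAt (deriv (complexCurve c)) t ∧
        ‖deriv (complexCurve c) t‖ ≤ M := by
  obtain ⟨n, τ, hτ, h0, h1, hs⟩ := h
  have hbound : ∀ i : Fin n, ∃ M, ∀ t ∈ Icc (τ i.castSucc) (τ i.succ),
      ‖derivWithin (complexCurve c) (Icc (τ i.castSucc) (τ i.succ)) t‖ ≤ M := fun i =>
    isCompact_Icc.exists_bound_of_continuousOn
      ((contDiffOn_complexCurve (hs i)).continuousOn_derivWithin
        (uniqueDiffOn_Icc (hτ Fin.castSucc_lt_succ)) (by simp))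
  choose M hM using hbound
  obtain ⟨B, hB⟩ := (Set.finite_range M).bddAbove
  refine ⟨range τ, finite_range τ, B, fun t ht => ?_⟩
  obtain ⟨i, hi⟩ := exists_mem_Ioc_of_strictMono (τ := τ) (h0.symm ▸ ht.1.1) (h1.symm ▸ ht.1.2.le)
  have hi' : t ∈ Ioo (τ i.castSucc) (τ i.succ) :=
    ⟨hi.1, lt_of_le_of_ne hi.2 fun h => ht.2 ⟨_, h.symm⟩⟩
  have hnhds := Icc_mem_nhds hi'.1 hi'.2
  have hd := contDiffOn_complexCurve (hs i)
  refine ⟨(hd.contDiffAt hnhds).differentiableAt (by simp), ?_, ?_⟩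
  · exact ((hd.mono Ioo_subset_Icc_self).continuousOn_deriv_of_isOpen isOpen_Ioo
      (by simp)).continuousAt (Ioo_mem_nhds hi'.1 hi'.2)
  · rw [← derivWithin_of_mem_nhds hnhds]
    exact (hM i t (Ioo_subset_Icc_self hi')).trans (hB ⟨i, rfl⟩)

theorem IsLoop.mono {U U' : Set SymTraceless} {p : SymTraceless} {c : ℝ → SymTraceless}
    (h : IsLoop U p c) (hU : U ⊆ U') : IsLoop U' p c :=
  { h with inside := fun t ht => hU (h.inside t ht) }

theorem IsLoop.isRegularCurve {U : Set SymTraceless} {p : SymTraceless} {c : ℝ → SymTraceless}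
    (h : IsLoop U p c) : IsRegularCurve (complexCurve c) where
  continuousOn := h.piecewiseSmooth.continuousOn
  exists_finite := h.piecewiseSmooth.exists_finite
  crossing t ht hz := by
    obtain ⟨h1, h2, h3⟩ := h.regular t ht (complexCurve_eq_zero.1 hz)
    refine ⟨h1, (toComplex.contDiff.contDiffAt.comp t h2).of_le ENat.LEInfty.out, ?_⟩
    rw [deriv_complexCurve]
    exact fun h0 => h3 (toComplex.map_eq_zero_iff.1 h0)

theorem integral_angularSpeed (c : ℝ → SymTraceless) :
    ∫ t in (0 : ℝ)..1, angularSpeed c t = angle (complexCurve c) 1 :=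
  intervalIntegral.integral_congr fun t _ => angularSpeed_eq c t

theorem windingNumber_eq (c : ℝ → SymTraceless) :
    windingNumber c = angle (complexCurve c) 1 / (2 * Real.pi) := by
  rw [windingNumber, integral_angularSpeed]
  ring

theorem IsLoop.intervalIntegrable_angularSpeed {U : Set SymTraceless} {p : SymTraceless}
    {c : ℝ → SymTraceless} (h : IsLoop U p c) :
    IntervalIntegrable (angularSpeed c) volume 0 1 :=
  h.isRegularCurve.intervalIntegrable_angSpeed.congr fun t _ => (angularSpeed_eq c t).symm

/-- Only almost everywhere, since at the finitely many zeros the connection form has a junk value.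
-/
theorem IsLoop.phaseDensity_ae_eq {U : Set SymTraceless} {p : SymTraceless}
    {c : ℝ → SymTraceless} (h : IsLoop U p c) :
    ∀ᵐ t, t ∈ uIoc (0 : ℝ) 1 → phaseDensity c t = angularSpeed c t / 2 := by
  have hnull := h.isRegularCurve.finite_zeros.measure_zero volume
  filter_upwards [measure_eq_zero_iff_ae_notMem.1 hnull] with t ht htI
  rw [uIoc_of_le zero_le_one] at htI
  refine connectionForm_eq (fun h0 => ht ⟨Ioc_subset_Icc_self htI, ?_⟩) _
  rw [complexCurve, h0, map_zero]

theorem IsLoop.intervalIntegrable_phaseDensity {U : Set SymTraceless} {p : SymTraceless}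
    {c : ℝ → SymTraceless} (h : IsLoop U p c) :
    IntervalIntegrable (phaseDensity c) volume 0 1 := by
  refine (h.intervalIntegrable_angularSpeed.div_const 2).congr_ae ?_
  rw [Filter.EventuallyEq, ae_restrict_iff' measurableSet_uIoc]
  filter_upwards [h.phaseDensity_ae_eq] with t ht htI using (ht htI).symm

theorem IsLoop.geometricPhase_eq {U : Set SymTraceless} {p : SymTraceless}
    {c : ℝ → SymTraceless} (h : IsLoop U p c) :
    geometricPhase c = angle (complexCurve c) 1 / 2 := by
  rw [geometricPhase, intervalIntegral.integral_congr_ae h.phaseDensity_ae_eq,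
    intervalIntegral.integral_div, integral_angularSpeed]

theorem IsLoop.geometricPhase_eq_pi_mul {U : Set SymTraceless} {p : SymTraceless}
    {c : ℝ → SymTraceless} (h : IsLoop U p c) :
    geometricPhase c = Real.pi * windingNumber c := by
  have := Real.pi_ne_zero
  rw [h.geometricPhase_eq, windingNumber_eq]
  field_simp

/-! ### Rotations in the reference frame -/

/-- The linear isomorphism sending `1` and `i` to the reference frame at the points whose squared
direction is `u`. -/
def frameEquiv (u : Circle) : ℂ ≃ₗ[ℝ] ℂ where
  -- With `u = e²` and `|e| = 1`, this is `1 / 2` on the line of `e` and `1` on the line of `i e`: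
  -- radial unit vectors have `g`-length `2`, tangential ones `1`. The inverse has the factors `2`
  -- and `1`.
  toFun w := (3 * w - u * (starRingEnd ℂ) w) / 4
  invFun v := (3 * v + u * (starRingEnd ℂ) v) / 2
  map_add' v w := by rw [map_add]; ring
  map_smul' a w := by
    simp only [Complex.real_smul, map_mul, Complex.conj_ofReal, RingHom.id_apply]
    ring
  left_inv w := by
    have h : (u : ℂ) * (starRingEnd ℂ) u = 1 := by
      rw [Complex.mul_conj, Circle.normSq_coe, Complex.ofReal_one]
    simp only [map_div₀, map_sub, map_mul, Complex.conj_conj, map_ofNat]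
    linear_combination (-w / 8) * h
  right_inv v := by
    have h : (u : ℂ) * (starRingEnd ℂ) u = 1 := by
      rw [Complex.mul_conj, Circle.normSq_coe, Complex.ofReal_one]
    simp only [map_div₀, map_add, map_mul, Complex.conj_conj, map_ofNat]
    linear_combination (-v / 8) * h

/-- The frame, as a map to the coordinate plane. -/
def framePlane (u : Circle) : ℂ ≃ₗ[ℝ] Plane := (frameEquiv u).trans toComplex.symm.toLinearEquiv

theorem toComplex_framePlane (u : Circle) (w : ℂ) :
    toComplex (framePlane u w) = (3 * w - u * (starRingEnd ℂ) w) / 4 :=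
  toComplex.apply_symm_apply _

/-- Rotations with respect to the reference frame. -/
def frameRotation (u : Circle) : Circle →* (Plane ≃ₗ[ℝ] Plane) where
  toFun a := (framePlane u).symm.trans ((rotation a).toLinearEquiv.trans (framePlane u))
  map_one' := by
    ext1 v
    simp
  map_mul' a b := by
    ext1 v
    simp

theorem frameRotation_framePlane (u a : Circle) (w : ℂ) :
    frameRotation u a (framePlane u w) = framePlane u (a * w) := by
  simp [frameRotation]

theorem frameRotation_injective (u : Circle) : Function.Injective (frameRotation u) := by
  intro a b h
  have h1 := congrArg (fun T : Plane ≃ₗ[ℝ] Plane => T (framePlane u 1)) h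
  simp only [frameRotation_framePlane, mul_one] at h1
  exact Circle.ext ((framePlane u).injective h1)

/-- The squared direction of a nonzero point. -/
def pointSqDir (p : SymTraceless) (hp : p ≠ 0) : Circle :=
  ⟨sqDir (toComplex (chart p)), mem_sphere_zero_iff_norm.2 (norm_sqDir
    (toComplex.map_eq_zero_iff.not.2 (chart.map_eq_zero_iff.not.2 hp)))⟩

theorem mul_normSq_eq_of_eq_sqDir {z u : ℂ} (hz : z ≠ 0) (h : u = sqDir z) :
    u * (z.re ^ 2 + z.im ^ 2 : ℝ) = z * z := by
  have h1 : (starRingEnd ℂ) z ≠ 0 := (map_ne_zero _).2 hz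
  have h2 : ((z.re ^ 2 + z.im ^ 2 : ℝ) : ℂ) = z * (starRingEnd ℂ) z := by
    rw [Complex.mul_conj, Complex.normSq_apply]
    push_cast
    ring
  rw [h, h2, sqDir]
  field_simp

theorem framePlane_pointSqDir {p : SymTraceless} (hp : p ≠ 0) :
    framePlane (pointSqDir p hp) 1 = frameOne (chart p) ∧
      framePlane (pointSqDir p hp) Complex.I = frameTwo (chart p) := by
  have hq : chart p ≠ 0 := chart.map_eq_zero_iff.not.2 hp
  have hz : toComplex (chart p) ≠ 0 := toComplex.map_eq_zero_iff.not.2 hq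
  have hn := normSq_pos hq
  have hu := mul_normSq_eq_of_eq_sqDir hz (u := pointSqDir p hp) rfl
  rw [frameOne_eq hq, frameTwo_eq hq]
  have hre := congrArg Complex.re hu
  have him := congrArg Complex.im hu
  rw [mul_comm, Complex.re_ofReal_mul] at hre
  rw [mul_comm, Complex.im_ofReal_mul] at him
  simp only [Complex.mul_re, Complex.mul_im, toComplex_re, toComplex_im] at hre him
  rw [mul_comm, ← eq_div_iff hn.ne'] at hre him
  constructor <;> apply toComplex.injective <;> rw [toComplex_framePlane] <;>
    apply Complex.ext <;> simp [hre, him] <;> field_simp <;> ring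

theorem isFrameRotation_frameRotation {p : SymTraceless} (hp : p ≠ 0) (θ : ℝ) :
    IsFrameRotation p θ (frameRotation (pointSqDir p hp) (Circle.exp θ)) := by
  obtain ⟨h1, h2⟩ := framePlane_pointSqDir hp
  rw [IsFrameRotation, ← h1, ← h2, frameRotation_framePlane, frameRotation_framePlane]
  simp only [← map_smul, ← map_add]
  constructor <;> congr 1 <;> rw [Circle.coe_exp, Complex.exp_mul_I] <;> apply Complex.ext <;>
    simp [← Complex.ofReal_cos, ← Complex.ofReal_sin]

/-! ### Parallel transport -/

/-- Writing `Im (V / z)` with the conjugate turns `z Im (V / z)` into `-(i / 2) (V - u conj V)`, so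
the transport equation sees the position only through `u` and the angular speed. -/
theorem toComplex_christoffelForm {q : Plane} (hq : q ≠ 0) (X V : Plane) :
    toComplex (christoffelForm q X V) = -(3 * Complex.I / 8 * angularForm q X *
      (toComplex V - sqDir (toComplex q) * (starRingEnd ℂ) (toComplex V))) := by
  have hz : toComplex q ≠ 0 := toComplex.map_eq_zero_iff.not.2 hq
  have hzc : (starRingEnd ℂ) (toComplex q) ≠ 0 := (map_ne_zero _).2 hz
  rw [christoffelForm_eq hq, map_smul, Complex.real_smul, angularForm_eq_im q V]
  have him : (((toComplex V / toComplex q).im : ℝ) : ℂ) = -(Complex.I / 2) *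
      (toComplex V / toComplex q - (starRingEnd ℂ) (toComplex V / toComplex q)) := by
    rw [Complex.sub_conj]
    push_cast
    linear_combination (((toComplex V / toComplex q).im : ℝ) : ℂ) * Complex.I_mul_I
  push_cast
  rw [him, map_div₀, sqDir]
  field_simp
  ring

theorem IsRegularCurve.curveSqDir_mul_conj {z : ℝ → ℂ} (h : IsRegularCurve z) {t : ℝ}
    (ht : t ∈ Icc (0 : ℝ) 1) : curveSqDir z t * (starRingEnd ℂ) (curveSqDir z t) = 1 := by
  rw [Complex.mul_conj, Complex.normSq_eq_norm_sq, norm_curveSqDir h ht]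
  norm_num

/-- The coefficient of a solution of the transport equation in the rotating frame turns by half
of the swept angle. -/
theorem IsRegularCurve.coframe_eq_of_transport {z W : ℝ → ℂ} (h : IsRegularCurve z)
    (hW : ContinuousOn W (Icc 0 1))
    (hd : ∀ t ∈ Ioo (0 : ℝ) 1, z t ≠ 0 → DifferentiableAt ℝ z t →
      HasDerivAt W (3 * Complex.I / 8 * angSpeed z t *
        (W t - sqDir (z t) * (starRingEnd ℂ) (W t))) t) {t : ℝ} (ht : t ∈ Icc (0 : ℝ) 1) :
    (3 * W t + curveSqDir z t * (starRingEnd ℂ) (W t)) / 2 =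
      Complex.exp (1 / 2 * Complex.I * angle z t) *
        ((3 * W 0 + curveSqDir z 0 * (starRingEnd ℂ) (W 0)) / 2) := by
  obtain ⟨S, hS, hS'⟩ := h.exists_finite_hasDerivAt_angle
  -- The frame coefficient, rotated back by `A / 2`, is stationary off finitely many times. It is
  -- continuous also at the zeros, so no freedom arises when the origin is crossed.
  have hconst := eq_of_hasDerivAt_zero_off_countable
    (f := fun t => Complex.exp (-(1 / 2) * Complex.I * angle z t) *
      ((3 * W t + curveSqDir z t * (starRingEnd ℂ) (W t)) / 2)) hS.countable
    ((h.continuousOn_cexp_angle _).mul (((continuousOn_const.mul hW).add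
      (h.continuousOn_curveSqDir.mul (Complex.continuous_conj.comp_continuousOn hW))).div_const _))
    (fun s hs => by
      obtain ⟨hz, hdz, ha⟩ := hS' s hs
      have hWd := hd s hs.1 hz hdz
      have h1 := (hasDerivAt_cexp_mul_I ha (-(1 / 2))).mul
        (((hWd.const_mul 3).add ((hasDerivAt_curveSqDir hz hdz).mul
          (hasDerivAt_conj_comp hWd))).div_const 2)
      convert! h1 using 1
      have hu := h.curveSqDir_mul_conj (Ioo_subset_Icc_self hs.1)
      have hus : curveSqDir z s = sqDir (z s) := by rw [curveSqDir, if_neg hz]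
      rw [hus] at hu
      simp only [Pi.add_apply, Pi.mul_apply, hus, map_mul, map_div₀, map_sub,
        Complex.conj_I, Complex.conj_ofReal,
        Complex.conj_conj, map_ofNat]
      linear_combination (-(3 / 16 * Complex.exp (-(1 / 2) * Complex.I * angle z s) * Complex.I *
        angSpeed z s * W s)) * hu) ht
  simp only [angle_zero, Complex.ofReal_zero, mul_zero, Complex.exp_zero, one_mul] at hconst
  rw [← hconst, ← mul_assoc, ← Complex.exp_add]
  ring_nf
  simp

/-- Solutions of the transport equation. -/
theorem IsRegularCurve.hasDerivAt_transport {z : ℝ → ℂ} (h : IsRegularCurve z) (w : ℂ) {t : ℝ}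
    (ht : t ∈ Ioo (0 : ℝ) 1) (hz : z t ≠ 0) (hd : DifferentiableAt ℝ z t) {W : ℝ → ℂ}
    (hW : ∀ t, W t = (3 * (Complex.exp (1 / 2 * Complex.I * angle z t) * w) -
      curveSqDir z t * (starRingEnd ℂ) (Complex.exp (1 / 2 * Complex.I * angle z t) * w)) / 4) :
    HasDerivAt W (3 * Complex.I / 8 * angSpeed z t *
        (W t - sqDir (z t) * (starRingEnd ℂ) (W t))) t := by
  have he := (hasDerivAt_cexp_mul_I (h.hasDerivAt_angle ht hz hd) (1 / 2)).mul_const w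
  have h1 := ((he.const_mul 3).sub
    ((hasDerivAt_curveSqDir hz hd).mul (hasDerivAt_conj_comp he))).div_const 4
  rw [funext hW]
  convert! h1 using 1
  have hu := h.curveSqDir_mul_conj (Ioo_subset_Icc_self ht)
  have hus : curveSqDir z t = sqDir (z t) := by rw [curveSqDir, if_neg hz]
  rw [hus] at hu
  simp only [hus, map_mul, map_div₀, map_sub,
        Complex.conj_I, Complex.conj_ofReal,
    Complex.conj_conj, map_ofNat, map_one]
  linear_combination (3 / 32 * Complex.I * angSpeed z t *
    Complex.exp (1 / 2 * Complex.I * angle z t) * w) * hu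

theorem isParallelAlong_iff {c : ℝ → SymTraceless} {V : ℝ → Plane} :
    IsParallelAlong c V ↔ ContinuousOn (fun t => toComplex (V t)) (Icc 0 1) ∧
      ∀ t ∈ Ioo (0 : ℝ) 1, complexCurve c t ≠ 0 → DifferentiableAt ℝ (complexCurve c) t →
        HasDerivAt (fun t => toComplex (V t))
          (3 * Complex.I / 8 * angSpeed (complexCurve c) t * (toComplex (V t) -
            sqDir (complexCurve c t) * (starRingEnd ℂ) (toComplex (V t)))) t := by
  refine and_congr (toComplex.comp_continuousOn_iff (f := V)).symm (forall₂_congr fun t ht => ?_)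
  have h0 : complexCurve c t ≠ 0 ↔ c t ≠ 0 := complexCurve_eq_zero.not
  rw [differentiableAt_complexCurve, h0]
  refine forall₂_congr fun hc hd => ?_
  have hq : coords c t ≠ 0 := coords_eq_zero.not.2 hc
  have hval : 3 * Complex.I / 8 * angSpeed (complexCurve c) t * (toComplex (V t) -
      sqDir (complexCurve c t) * (starRingEnd ℂ) (toComplex (V t))) =
      toComplex (-christoffelForm (coords c t) (velocity c t) (V t)) := by
    rw [map_neg, toComplex_christoffelForm hq, ← angularSpeed_eq, neg_neg]
    rfl
  rw [hval]
  constructor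
  · intro h
    exact toComplex.toContinuousLinearMap.hasFDerivAt.comp_hasDerivAt t h
  · intro h
    have h1 := toComplex.symm.toContinuousLinearMap.hasFDerivAt.comp_hasDerivAt t h
    convert! h1 using 1
    · ext1 s; exact (toComplex.symm_apply_apply _).symm
    · exact (toComplex.symm_apply_apply _).symm

theorem framePlane_symm_apply (u : Circle) (v : Plane) :
    (framePlane u).symm v = (3 * toComplex v + u * (starRingEnd ℂ) (toComplex v)) / 2 := rfl

/-- Parallel transport around a loop is the rotation by the geometric phase. -/
theorem IsLoop.isParallelTransport {U : Set SymTraceless} {p : SymTraceless}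
    {c : ℝ → SymTraceless} (h : IsLoop U p c) (hp : p ≠ 0) :
    IsParallelTransport c (frameRotation (pointSqDir p hp) (Circle.exp (geometricPhase c))) := by
  have hz := h.isRegularCurve
  set u := pointSqDir p hp with hu
  -- Both ends of the loop carry the frame at `p`.
  have hend : ∀ t, c t = p → curveSqDir (complexCurve c) t = u := by
    intro t ht
    have : complexCurve c t ≠ 0 := complexCurve_eq_zero.not.2 (ht.symm ▸ hp)
    rw [curveSqDir, if_neg this, complexCurve, coords, ht]
    rfl
  have hu0 := hend 0 h.start
  have hu1 := hend 1 h.finish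
  have hexp : (Circle.exp (geometricPhase c) : ℂ) =
      Complex.exp (1 / 2 * Complex.I * angle (complexCurve c) 1) := by
    rw [Circle.coe_exp, h.geometricPhase_eq]
    push_cast
    ring_nf
  intro v w
  have hv : ∀ a : Circle, frameRotation u a v = framePlane u (a * (framePlane u).symm v) := by
    intro a
    rw [← frameRotation_framePlane, LinearEquiv.apply_symm_apply]
  rw [hv, hexp]
  constructor
  · rintro rfl
    set b := (framePlane u).symm v with hb
    set W : ℝ → ℂ := fun t =>
      (3 * (Complex.exp (1 / 2 * Complex.I * angle (complexCurve c) t) * b) -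
        curveSqDir (complexCurve c) t * (starRingEnd ℂ)
          (Complex.exp (1 / 2 * Complex.I * angle (complexCurve c) t) * b)) / 4 with hW
    have hWV : ∀ t, toComplex (toComplex.symm (W t)) = W t := fun t =>
      toComplex.apply_symm_apply _
    refine ⟨fun t => toComplex.symm (W t), isParallelAlong_iff.2 ⟨?_, fun t ht h0 hd => ?_⟩, ?_, ?_⟩
    · simp only [hWV]
      have hec := (hz.continuousOn_cexp_angle (1 / 2)).mul (continuousOn_const (c := b))
      exact ((continuousOn_const.mul hec).sub (hz.continuousOn_curveSqDir.mul
        (Complex.continuous_conj.comp_continuousOn hec))).div_const _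
    · simp only [hWV]
      exact hz.hasDerivAt_transport b ht h0 hd fun _ => rfl
    · apply toComplex.injective
      rw [hWV, hW]
      simp only [angle_zero, Complex.ofReal_zero, mul_zero, Complex.exp_zero, one_mul, hu0]
      rw [← toComplex_framePlane, hb, LinearEquiv.apply_symm_apply]
    · apply toComplex.injective
      rw [hWV, hW]
      simp only [hu1]
      rw [← toComplex_framePlane]
  · rintro ⟨V, hV, rfl, rfl⟩
    rw [isParallelAlong_iff] at hV
    have h1 := hz.coframe_eq_of_transport hV.1 hV.2 (right_mem_Icc.2 zero_le_one)
    rw [hu0, hu1] at h1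
    rw [framePlane_symm_apply, ← h1, ← framePlane_symm_apply, LinearEquiv.apply_symm_apply]

theorem IsParallelTransport.unique {c : ℝ → SymTraceless} {T T' : Plane ≃ₗ[ℝ] Plane}
    (h : IsParallelTransport c T) (h' : IsParallelTransport c T') : T = T' := by
  ext1 v
  exact (((h' v (T' v)).1 rfl |> (h v (T' v)).2))

/-- If the phases of the loops are the multiples of `δ`, then the holonomy is the cyclic group
generated by the rotation by `δ`. -/
theorem holonomy_eq_zpowers {U : Set SymTraceless} {p : SymTraceless} (hp : p ≠ 0) {δ : ℝ}
    (h1 : ∀ c, IsLoop U p c → ∃ k : ℤ, geometricPhase c = k * δ)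
    (h2 : ∀ k : ℤ, ∃ c, IsLoop U p c ∧ geometricPhase c = k * δ) :
    (Subgroup.zpowers (frameRotation (pointSqDir p hp) (Circle.exp δ)) :
        Set (Plane ≃ₗ[ℝ] Plane)) = holonomy U p ∧
      phases U p = {a : Real.Angle | ∃ k : ℤ, a = ((k * δ : ℝ) : Real.Angle)} := by
  have hexp : ∀ k : ℤ, frameRotation (pointSqDir p hp) (Circle.exp (k * δ)) =
      frameRotation (pointSqDir p hp) (Circle.exp δ) ^ k := by
    intro k
    rw [← map_zpow, ← zsmul_eq_mul, Circle.exp_zsmul]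
  constructor
  · ext T
    constructor
    · rintro ⟨k, rfl⟩
      obtain ⟨c, hc, hk⟩ := h2 k
      refine ⟨c, hc, ?_⟩
      have := hc.isParallelTransport hp
      rwa [hk, hexp] at this
    · rintro ⟨c, hc, hT⟩
      obtain ⟨k, hk⟩ := h1 c hc
      refine ⟨k, ?_⟩
      have := hc.isParallelTransport hp
      rw [hk, hexp] at this
      exact this.unique hT
  · ext a
    constructor
    · rintro ⟨c, hc, rfl⟩
      obtain ⟨k, hk⟩ := h1 c hc
      exact ⟨k, by rw [hk]⟩
    · rintro ⟨k, rfl⟩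
      obtain ⟨c, hc, hk⟩ := h2 k
      exact ⟨c, hc, by rw [hk]⟩

theorem nonempty_zpowers_frameRotation_mulEquiv (u : Circle) {a : Circle} {n : ℕ}
    (ha : orderOf a = n) :
    Nonempty (Subgroup.zpowers (frameRotation u a) ≃* Multiplicative (ZMod n)) := by
  have hcard : Nat.card (Subgroup.zpowers (frameRotation u a)) = n := by
    rw [Nat.card_zpowers, orderOf_injective _ (frameRotation_injective u), ha]
  have h := zmodCyclicMulEquiv (G := Subgroup.zpowers (frameRotation u a)) inferInstance
  rw [hcard] at h
  exact ⟨h.symm⟩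

theorem orderOf_exp_pi : orderOf (Circle.exp Real.pi) = 2 := by
  have h : (Circle.exp Real.pi : ℂ) = -1 := by rw [Circle.coe_exp, Complex.exp_pi_mul_I]
  apply orderOf_eq_prime
  · apply Circle.ext
    rw [Circle.coe_pow, h]
    norm_num
  · intro h1
    rw [h1] at h
    norm_num at h

theorem orderOf_exp_pi_div_two : orderOf (Circle.exp (Real.pi / 2)) = 4 := by
  have h : (Circle.exp (Real.pi / 2) : ℂ) = Complex.I := by
    rw [Circle.coe_exp]
    push_cast
    exact Complex.exp_pi_div_two_mul_I
  have h2 : ((Circle.exp (Real.pi / 2) ^ 2 : Circle) : ℂ) = -1 := by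
    rw [Circle.coe_pow, h, Complex.I_sq]
  refine orderOf_eq_prime_pow (p := 2) (n := 1) ?_ ?_
  · intro h1
    rw [pow_one] at h1
    rw [h1] at h2
    norm_num at h2
  · apply Circle.ext
    rw [show 2 ^ (1 + 1) = 2 * 2 by norm_num, pow_mul, Circle.coe_pow, h2]
    norm_num

/-! ### Circles -/

/-- The curve with a given complex coordinate. -/
def curveOf (f : ℝ → ℂ) (t : ℝ) : SymTraceless := chart.symm (toComplex.symm (f t))

theorem coords_curveOf (f : ℝ → ℂ) : coords (curveOf f) = fun t => toComplex.symm (f t) :=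
  funext fun _ => chart.apply_symm_apply _

theorem complexCurve_curveOf (f : ℝ → ℂ) : complexCurve (curveOf f) = f := by
  ext1 t
  rw [complexCurve, coords_curveOf, ContinuousLinearEquiv.apply_symm_apply]

theorem contDiff_coords_curveOf {f : ℝ → ℂ} (hf : ContDiff ℝ ∞ f) :
    ContDiff ℝ ∞ (coords (curveOf f)) := by
  rw [coords_curveOf]
  exact toComplex.symm.contDiff.comp hf

theorem velocity_ne_zero_iff {c : ℝ → SymTraceless} {t : ℝ} :
    velocity c t ≠ 0 ↔ deriv (complexCurve c) t ≠ 0 := by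
  rw [deriv_complexCurve]
  exact toComplex.map_eq_zero_iff.not.symm

theorem isLoop_of_contDiff {U : Set SymTraceless} {p : SymTraceless} (hp : p ≠ 0)
    {c : ℝ → SymTraceless} (hc : ContDiff ℝ ∞ (coords c)) (h0 : c 0 = p) (h1 : c 1 = p)
    (hU : ∀ t, c t ∈ U) (hreg : ∀ t, c t = 0 → velocity c t ≠ 0) : IsLoop U p c where
  start := h0
  finish := h1
  inside t _ := hU t
  piecewiseSmooth := by
    refine ⟨1, ![0, 1], ?_, rfl, rfl, fun _ => hc.contDiffOn⟩
    intro i j hij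
    fin_cases i <;> fin_cases j <;> simp at hij ⊢
  regular t ht hz := by
    refine ⟨⟨lt_of_le_of_ne ht.1 ?_, lt_of_le_of_ne ht.2 ?_⟩, hc.contDiffAt, hreg t hz⟩
    · rintro rfl; exact hp (h0.symm.trans hz)
    · rintro rfl; exact hp (h1.symm.trans hz)

/-- The point `e^{2πikt}` of the unit circle. -/
def turn (k : ℤ) (t : ℝ) : ℂ := Complex.exp (2 * Real.pi * k * Complex.I * t)

theorem turn_ne_zero (k : ℤ) (t : ℝ) : turn k t ≠ 0 := Complex.exp_ne_zero _

theorem contDiff_turn (k : ℤ) : ContDiff ℝ ∞ (turn k) := by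
  unfold turn
  exact (contDiff_const.mul Complex.ofRealCLM.contDiff).cexp

theorem hasDerivAt_turn (k : ℤ) (t : ℝ) :
    HasDerivAt (turn k) (2 * Real.pi * k * Complex.I * turn k t) t := by
  have h := ((hasDerivAt_id t).ofReal_comp.const_mul (2 * Real.pi * k * Complex.I)).cexp
  convert! h using 1
  simp [turn, mul_comm]

theorem turn_add_one (k : ℤ) (t : ℝ) : turn k (t + 1) = turn k t := by
  rw [turn, turn, Complex.exp_eq_exp_iff_exists_int]
  refine ⟨k, ?_⟩
  push_cast
  ring

theorem turn_zero (k : ℤ) : turn k 0 = 1 := by simp [turn]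

theorem turn_one (k : ℤ) : turn k 1 = 1 := by
  rw [← turn_zero k, ← turn_add_one k 0, zero_add]

theorem conj_turn (k : ℤ) (t : ℝ) : (starRingEnd ℂ) (turn k t) = (turn k t)⁻¹ := by
  rw [turn, ← Complex.exp_conj, ← Complex.exp_neg]
  simp only [map_mul, map_ofNat, map_intCast, Complex.conj_ofReal, Complex.conj_I]
  ring_nf

theorem injOn_turn_one : InjOn (turn 1) (Ico 0 1) := by
  intro s hs t ht hst
  rw [turn, turn, Complex.exp_eq_exp_iff_exists_int] at hst
  obtain ⟨n, hn⟩ := hst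
  have hpi : (2 * Real.pi * Complex.I : ℂ) ≠ 0 := Complex.two_pi_I_ne_zero
  have h1 : (s : ℂ) = t + n := by
    apply mul_left_cancel₀ hpi
    push_cast at hn
    linear_combination hn
  have h2 : s = t + n := by exact_mod_cast h1
  have h3 : (n : ℝ) < 1 := by linarith [hs.2, ht.1]
  have h4 : (-1 : ℝ) < n := by linarith [hs.1, ht.2]
  have h3' : n < 1 := by exact_mod_cast h3
  have h4' : -1 < n := by exact_mod_cast h4
  have : n = 0 := by omega
  rw [h2, this]
  simp

/-- At a zero of `z` the angular speed has the default value `0`, but zeros form a null set. -/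
theorem angle_eq_of_angSpeed_eq {z : ℝ → ℂ} (h : IsRegularCurve z) {a : ℝ}
    (ha : ∀ t, z t ≠ 0 → angSpeed z t = a) : angle z 1 = a := by
  rw [angle, intervalIntegral.integral_congr_ae (g := fun _ => a)]
  · simp
  filter_upwards [measure_eq_zero_iff_ae_notMem.1 (h.finite_zeros.measure_zero volume)]
    with t ht htI
  rw [uIoc_of_le zero_le_one] at htI
  exact ha t fun h0 => ht ⟨Ioc_subset_Icc_self htI, h0⟩

/-- The circle through `p` about the origin, run through `k` times. -/
def centralCircle (p : SymTraceless) (k : ℤ) : ℝ → SymTraceless :=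
  curveOf fun t => toComplex (chart p) * turn k t

/-- The circle with diameter from `0` to `p`, run through `k` times. -/
def diameterCircle (p : SymTraceless) (k : ℤ) : ℝ → SymTraceless :=
  curveOf fun t => toComplex (chart p) * ((1 + turn k t) / 2)

theorem toComplex_chart_ne_zero {p : SymTraceless} (hp : p ≠ 0) : toComplex (chart p) ≠ 0 :=
  toComplex.map_eq_zero_iff.not.2 (chart.map_eq_zero_iff.not.2 hp)

theorem curveOf_eq {f : ℝ → ℂ} {p : SymTraceless} {t : ℝ} (h : f t = toComplex (chart p)) :
    curveOf f t = p := by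
  rw [curveOf, h, ContinuousLinearEquiv.symm_apply_apply, LinearEquiv.symm_apply_apply]

theorem curveOf_eq_zero {f : ℝ → ℂ} {t : ℝ} : curveOf f t = 0 ↔ f t = 0 := by
  rw [← complexCurve_eq_zero, complexCurve_curveOf]

theorem isLoop_centralCircle {p : SymTraceless} (hp : p ≠ 0) (k : ℤ) :
    IsLoop {0}ᶜ p (centralCircle p k) := by
  have hne : ∀ t, centralCircle p k t ≠ 0 := fun t h0 =>
    mul_ne_zero (toComplex_chart_ne_zero hp) (turn_ne_zero k t) (curveOf_eq_zero.1 h0)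
  exact isLoop_of_contDiff hp
    (contDiff_coords_curveOf (contDiff_const.mul (contDiff_turn k)))
    (curveOf_eq (by rw [turn_zero, mul_one])) (curveOf_eq (by rw [turn_one, mul_one])) hne
    fun t h0 => absurd h0 (hne t)

theorem angle_centralCircle {p : SymTraceless} (hp : p ≠ 0) (k : ℤ) :
    angle (complexCurve (centralCircle p k)) 1 = k * (2 * Real.pi) := by
  refine angle_eq_of_angSpeed_eq (isLoop_centralCircle hp k).isRegularCurve fun t _ => ?_
  rw [centralCircle, complexCurve_curveOf, angSpeed, ((hasDerivAt_turn k t).const_mul _).deriv]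
  have h1 := toComplex_chart_ne_zero hp
  have h2 := turn_ne_zero k t
  have h3 : toComplex (chart p) * (2 * Real.pi * k * Complex.I * turn k t) /
      (toComplex (chart p) * turn k t) = ((k * (2 * Real.pi) : ℝ) : ℂ) * Complex.I := by
    push_cast
    field_simp
  rw [h3, Complex.im_ofReal_mul, Complex.I_im, mul_one]

theorem hasDerivAt_diameterCircle (P : ℂ) (k : ℤ) (t : ℝ) :
    HasDerivAt (fun t => P * ((1 + turn k t) / 2))
      (P * (2 * Real.pi * k * Complex.I * turn k t / 2)) t :=
  (((hasDerivAt_turn k t).const_add 1).div_const 2).const_mul P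

theorem isLoop_diameterCircle {p : SymTraceless} (hp : p ≠ 0) (k : ℤ) :
    IsLoop univ p (diameterCircle p k) := by
  refine isLoop_of_contDiff hp
    (contDiff_coords_curveOf (contDiff_const.mul
      ((contDiff_const.add (contDiff_turn k)).div_const 2)))
    (curveOf_eq (by rw [turn_zero]; ring)) (curveOf_eq (by rw [turn_one]; ring))
    (fun _ => mem_univ _) fun t h0 => ?_
  rw [velocity_ne_zero_iff, diameterCircle, complexCurve_curveOf,
    (hasDerivAt_diameterCircle _ k t).deriv]
  -- For `k = 0` the curve is constant at `p` and never meets the origin.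
  have hk : (k : ℂ) ≠ 0 := by
    rintro hk
    have hk' : k = 0 := by exact_mod_cast hk
    have h1 := curveOf_eq_zero.1 h0
    rw [hk', turn] at h1
    apply toComplex_chart_ne_zero hp
    simpa using h1
  have hpi : (Real.pi : ℂ) ≠ 0 := by exact_mod_cast Real.pi_ne_zero
  simp [turn_ne_zero k t, toComplex_chart_ne_zero hp, hpi, hk]

/-- This is the inscribed angle theorem: seen from a point of the circle, the angular speed is half
of that seen from the centre, since `e / (1 + e)` has real part `1 / 2` when `|e| = 1` and `e ≠ -1`.
-/
theorem angle_diameterCircle {p : SymTraceless} (hp : p ≠ 0) (k : ℤ) :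
    angle (complexCurve (diameterCircle p k)) 1 = k * Real.pi := by
  refine angle_eq_of_angSpeed_eq (isLoop_diameterCircle hp k).isRegularCurve fun t h0 => ?_
  rw [diameterCircle, complexCurve_curveOf] at h0 ⊢
  rw [angSpeed, (hasDerivAt_diameterCircle _ k t).deriv]
  have h1 := toComplex_chart_ne_zero hp
  have h2 := turn_ne_zero k t
  have h3 : 1 + turn k t ≠ 0 := fun h => h0 (by rw [h]; ring)
  have h4 : toComplex (chart p) * (2 * Real.pi * k * Complex.I * turn k t / 2) /
      (toComplex (chart p) * ((1 + turn k t) / 2)) =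
      ((2 * (k * Real.pi) : ℝ) : ℂ) * (Complex.I * (turn k t / (1 + turn k t))) := by
    push_cast
    field_simp
  have h5 : (turn k t / (1 + turn k t)).re = 1 / 2 := by
    have h6 := Complex.add_conj (turn k t / (1 + turn k t))
    rw [map_div₀, map_add, map_one, conj_turn] at h6
    have h7 : turn k t / (1 + turn k t) + (turn k t)⁻¹ / (1 + (turn k t)⁻¹) = 1 := by
      have h8 : 1 + (turn k t)⁻¹ = (1 + turn k t) / turn k t := by
        field_simp
        ring
      rw [h8]
      field_simp
      ring
    rw [h7] at h6
    have h9 : (1 : ℝ) = 2 * (turn k t / (1 + turn k t)).re := by exact_mod_cast h6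
    linarith
  rw [h4, Complex.im_ofReal_mul, Complex.I_mul_im, h5]
  ring

theorem isSmoothSimpleClosed_curveOf {f : ℝ → ℂ} (hf : ContDiff ℝ ∞ f)
    (hp : Function.Periodic f 1) (hreg : ∀ t, deriv f t ≠ 0) (hinj : InjOn f (Ico 0 1)) :
    IsSmoothSimpleClosed (curveOf f) where
  smooth := contDiff_coords_curveOf hf
  periodic t := by rw [curveOf, curveOf, hp t]
  regular t := by rw [velocity_ne_zero_iff, complexCurve_curveOf]; exact hreg t
  simple s hs t ht h := by
    apply hinj hs ht
    have := complexCurve_eq_iff.2 h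
    rwa [complexCurve_curveOf] at this

theorem turn_one_deriv_factor_ne_zero (t : ℝ) :
    2 * Real.pi * ((1 : ℤ) : ℂ) * Complex.I * turn 1 t ≠ 0 := by
  push_cast
  rw [mul_one]
  exact mul_ne_zero Complex.two_pi_I_ne_zero (turn_ne_zero 1 t)

theorem isSmoothSimpleClosed_centralCircle {p : SymTraceless} (hp : p ≠ 0) :
    IsSmoothSimpleClosed (centralCircle p 1) := by
  have hP := toComplex_chart_ne_zero hp
  refine isSmoothSimpleClosed_curveOf (contDiff_const.mul (contDiff_turn 1))
    (fun t => by rw [turn_add_one]) (fun t => ?_) fun s hs t ht h => ?_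
  · rw [((hasDerivAt_turn 1 t).const_mul _).deriv]
    exact mul_ne_zero hP (turn_one_deriv_factor_ne_zero t)
  · exact injOn_turn_one hs ht (mul_left_cancel₀ hP h)

theorem isSmoothSimpleClosed_diameterCircle {p : SymTraceless} (hp : p ≠ 0) :
    IsSmoothSimpleClosed (diameterCircle p 1) := by
  have hP := toComplex_chart_ne_zero hp
  refine isSmoothSimpleClosed_curveOf (contDiff_const.mul
    ((contDiff_const.add (contDiff_turn 1)).div_const 2))
    (fun t => by rw [turn_add_one]) (fun t => ?_) fun s hs t ht h => ?_
  · rw [(hasDerivAt_diameterCircle _ 1 t).deriv]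
    exact mul_ne_zero hP (div_ne_zero (turn_one_deriv_factor_ne_zero t) two_ne_zero)
  · refine injOn_turn_one hs ht ?_
    have := mul_left_cancel₀ hP h
    linear_combination 2 * this

theorem diameterCircle_half (p : SymTraceless) : diameterCircle p 1 (1 / 2) = 0 := by
  refine curveOf_eq_zero.2 ?_
  have : turn 1 (1 / 2) = -1 := by
    rw [turn, ← Complex.exp_pi_mul_I]
    congr 1
    push_cast
    ring
  rw [this]
  ring

/-! ### Simple closed curves through the origin -/

theorem velocity_comp_add (c : ℝ → SymTraceless) (a t : ℝ) :
    velocity (fun s => c (s + a)) t = velocity c (t + a) :=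
  deriv_comp_add_const (coords c) a t

theorem integral_comp_add_of_periodic {f : ℝ → ℝ} (hf : Function.Periodic f 1) (a : ℝ) :
    ∫ t in (0 : ℝ)..1, f (t + a) = ∫ t in (0 : ℝ)..1, f t := by
  rw [intervalIntegral.integral_comp_add_right, zero_add, add_comm 1 a,
    hf.intervalIntegral_add_eq a 0, zero_add]

theorem IsSmoothSimpleClosed.velocity_periodic {c : ℝ → SymTraceless}
    (h : IsSmoothSimpleClosed c) : Function.Periodic (velocity c) 1 := fun t => by
  rw [← velocity_comp_add]
  simp only [h.periodic _]

theorem IsSmoothSimpleClosed.isLoop {c : ℝ → SymTraceless} (h : IsSmoothSimpleClosed c)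
    (h0 : c 0 ≠ 0) : IsLoop univ (c 0) c :=
  isLoop_of_contDiff h0 h.smooth rfl (by simpa using h.periodic 0) (fun _ => mem_univ _)
    fun t _ => h.regular t

/-- A smooth simple closed curve through the origin has winding number `± 1/2` and phase
`± π/2`. -/
theorem IsSmoothSimpleClosed.windingNumber_and_phase {c : ℝ → SymTraceless}
    (h : IsSmoothSimpleClosed c) {s : ℝ} (hs : c s = 0) :
    (windingNumber c = 1 / 2 ∧ geometricPhase c = Real.pi / 2) ∨
      (windingNumber c = -(1 / 2) ∧ geometricPhase c = -(Real.pi / 2)) := by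
  -- The curve may start at the origin, where no loop may be based. Shifting the start to half a
  -- period after the zero avoids this, and by periodicity changes neither integral.
  set a := s + 1 / 2 with ha
  set d : ℝ → SymTraceless := fun t => c (t + a) with hd
  have hd0 : d 0 ≠ 0 := by
    intro h0
    obtain ⟨k, hk⟩ := exists_int_sub_eq h.periodic h.simple (h0.trans hs.symm)
    have h1 : (2 * k : ℝ) = 1 := by rw [← hk]; simp only [ha]; ring
    have h2 : 2 * k = 1 := by exact_mod_cast h1
    omega
  have hloop : IsLoop univ (d 0) d := by
    refine isLoop_of_contDiff hd0 (h.smooth.comp (contDiff_id.add contDiff_const)) rfl ?_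
      (fun _ => mem_univ _) fun t _ => ?_
    · simp only [hd]
      rw [add_comm 1 a, h.periodic, zero_add]
    · rw [velocity_comp_add]
      exact h.regular _
  have hper : ∀ F : Plane → Plane → ℝ,
      Function.Periodic (fun t => F (coords c t) (velocity c t)) 1 := fun F t => by
    simp only [coords, h.periodic t, h.velocity_periodic t]
  have hspeed : ∀ t, angularSpeed d t = angularSpeed c (t + a) := fun t => by
    rw [angularSpeed, velocity_comp_add]
    rfl
  have hphase : ∀ t, phaseDensity d t = phaseDensity c (t + a) := fun t => by
    rw [phaseDensity, velocity_comp_add]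
    rfl
  have hW : windingNumber d = windingNumber c := by
    rw [windingNumber, windingNumber]
    simp only [hspeed]
    exact congrArg _ (integral_comp_add_of_periodic (hper angularForm) a)
  have hθ : geometricPhase d = geometricPhase c := by
    rw [geometricPhase, geometricPhase]
    simp only [hphase]
    exact integral_comp_add_of_periodic (hper connectionForm) a
  have hmain := hloop.geometricPhase_eq_pi_mul
  rw [hW, hθ] at hmain
  have hint : IntervalIntegrable (angularSpeed c) volume s (s + 1) := by
    have h1 := hloop.intervalIntegrable_angularSpeed.comp_sub_right a
    refine (hper angularForm).intervalIntegrable one_ne_zero (t := a) ?_ s (s + 1)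
    rw [zero_add, add_comm 1 a] at h1
    refine h1.congr fun t _ => ?_
    simp only [hspeed, sub_add_cancel]
    rfl
  have hcs : angularSpeed c = angSpeed (complexCurve c) := funext (angularSpeed_eq c)
  have hsmooth : ContDiff ℝ 1 (complexCurve c) :=
    (toComplex.contDiff.comp h.smooth).of_le (by simp)
  have hint' : ∫ t in s..s + 1, angularSpeed c t = ∫ t in (0 : ℝ)..1, angularSpeed c t := by
    have := (hper angularForm).intervalIntegral_add_eq s 0
    rwa [zero_add] at this
  have hpm := integral_angSpeed_of_simple_closed hsmooth
    (fun t => complexCurve_eq_iff.2 (h.periodic t))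
    (fun t => velocity_ne_zero_iff.1 (h.regular t))
    (fun x hx y hy hxy => h.simple hx hy (complexCurve_eq_iff.1 hxy))
    (complexCurve_eq_zero.2 hs) (hcs ▸ hint)
  rw [← hcs, hint'] at hpm
  have hpi := Real.pi_ne_zero
  rcases hpm with hpm | hpm
  · left
    have hw : windingNumber c = 1 / 2 := by
      rw [windingNumber, hpm]
      field_simp
    exact ⟨hw, by rw [hmain, hw]; ring⟩
  · right
    have hw : windingNumber c = -(1 / 2) := by
      rw [windingNumber, hpm]
      field_simp
    exact ⟨hw, by rw [hmain, hw]; ring⟩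

/-! ### The holonomy groups -/

theorem IsLoop.exists_geometricPhase_eq {p : SymTraceless} (hp : p ≠ 0) {c : ℝ → SymTraceless}
    (h : IsLoop univ p c) : ∃ k : ℤ, geometricPhase c = k * (Real.pi / 2) := by
  obtain ⟨k, hk⟩ := h.isRegularCurve.exists_angle_eq
    (complexCurve_eq_zero.not.2 (h.start.symm ▸ hp))
    (complexCurve_eq_iff.2 (h.finish.trans h.start.symm))
  exact ⟨k, by rw [h.geometricPhase_eq, hk]; ring⟩

theorem IsLoop.exists_geometricPhase_eq_of_compl {p : SymTraceless} {c : ℝ → SymTraceless}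
    (h : IsLoop {0}ᶜ p c) : ∃ k : ℤ, geometricPhase c = k * Real.pi := by
  obtain ⟨k, hk⟩ := h.isRegularCurve.exists_angle_eq_of_ne_zero
    (fun t ht => complexCurve_eq_zero.not.2 (h.inside t ht))
    (complexCurve_eq_iff.2 (h.finish.trans h.start.symm))
  exact ⟨k, by rw [h.geometricPhase_eq, hk]; ring⟩

end ConeHolonomy

end

open ConeHolonomy in
theorem mainTheorem4 (p : ConeHolonomy.SymTraceless) (hp : p ≠ 0) :
    -- Parallel transport around each loop exists and is the rotation by the geometric phase,
    -- which is `π` times the winding number.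
    (∀ c : ℝ → ConeHolonomy.SymTraceless, ConeHolonomy.IsLoop Set.univ p c →
      IntervalIntegrable (ConeHolonomy.phaseDensity c) MeasureTheory.volume 0 1 ∧
      IntervalIntegrable (ConeHolonomy.angularSpeed c) MeasureTheory.volume 0 1 ∧
      ConeHolonomy.geometricPhase c = Real.pi * ConeHolonomy.windingNumber c ∧
      ∃ T : ConeHolonomy.Plane ≃ₗ[ℝ] ConeHolonomy.Plane,
        ConeHolonomy.IsParallelTransport c T ∧
        ConeHolonomy.IsFrameRotation p (ConeHolonomy.geometricPhase c) T) ∧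
    -- The holonomy group of `Σ ∖ {0}`.
    (∃ H : Subgroup (ConeHolonomy.Plane ≃ₗ[ℝ] ConeHolonomy.Plane),
      (H : Set (ConeHolonomy.Plane ≃ₗ[ℝ] ConeHolonomy.Plane)) = ConeHolonomy.holonomy {0}ᶜ p ∧
      Nonempty (H ≃* Multiplicative (ZMod 2)) ∧
      ConeHolonomy.phases {0}ᶜ p =
        {a : Real.Angle | ∃ k : ℤ, a = (((k : ℝ) * Real.pi : ℝ) : Real.Angle)} ∧
      (∃ c : ℝ → ConeHolonomy.SymTraceless, ConeHolonomy.IsLoop {0}ᶜ p c ∧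
        ConeHolonomy.IsSmoothSimpleClosed c ∧ ConeHolonomy.windingNumber c = 1) ∧
      (∀ c : ℝ → ConeHolonomy.SymTraceless, ConeHolonomy.IsLoop {0}ᶜ p c →
        ConeHolonomy.windingNumber c = 1 →
          ConeHolonomy.geometricPhase c = Real.pi ∧
          ∀ T : ConeHolonomy.Plane ≃ₗ[ℝ] ConeHolonomy.Plane,
            ConeHolonomy.IsParallelTransport c T → H = Subgroup.zpowers T)) ∧
    -- The holonomy group of `Σ`.
    (∃ H : Subgroup (ConeHolonomy.Plane ≃ₗ[ℝ] ConeHolonomy.Plane),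
      (H : Set (ConeHolonomy.Plane ≃ₗ[ℝ] ConeHolonomy.Plane)) =
        ConeHolonomy.holonomy Set.univ p ∧
      Nonempty (H ≃* Multiplicative (ZMod 4)) ∧
      ConeHolonomy.phases Set.univ p =
        {a : Real.Angle | ∃ k : ℤ, a = (((k : ℝ) * (Real.pi / 2) : ℝ) : Real.Angle)} ∧
      (∃ c : ℝ → ConeHolonomy.SymTraceless, ConeHolonomy.IsLoop Set.univ p c ∧
        ConeHolonomy.IsSmoothSimpleClosed c ∧ (∃ t, c t = 0) ∧
        ConeHolonomy.windingNumber c = 1 / 2) ∧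
      (∀ c : ℝ → ConeHolonomy.SymTraceless, ConeHolonomy.IsSmoothSimpleClosed c →
        (∃ t, c t = 0) →
          ((ConeHolonomy.windingNumber c = 1 / 2 ∧
              ConeHolonomy.geometricPhase c = Real.pi / 2) ∨
            (ConeHolonomy.windingNumber c = -(1 / 2) ∧
              ConeHolonomy.geometricPhase c = -(Real.pi / 2))) ∧
          (c 0 = p → ∀ T : ConeHolonomy.Plane ≃ₗ[ℝ] ConeHolonomy.Plane,
            ConeHolonomy.IsParallelTransport c T → H = Subgroup.zpowers T))) := by

  have hpi := Real.pi_ne_zero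
  obtain ⟨hol1, ph1⟩ := holonomy_eq_zpowers hp (U := {0}ᶜ) (δ := Real.pi)
    (fun c hc => hc.exists_geometricPhase_eq_of_compl)
    (fun k => ⟨_, isLoop_centralCircle hp k, by
      rw [(isLoop_centralCircle hp k).geometricPhase_eq, angle_centralCircle hp]; ring⟩)
  obtain ⟨hol2, ph2⟩ := holonomy_eq_zpowers hp (U := Set.univ) (δ := Real.pi / 2)
    (fun c hc => hc.exists_geometricPhase_eq hp)
    (fun k => ⟨_, isLoop_diameterCircle hp k, by
      rw [(isLoop_diameterCircle hp k).geometricPhase_eq, angle_diameterCircle hp]; ring⟩)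
  refine ⟨fun c hc => ⟨hc.intervalIntegrable_phaseDensity, hc.intervalIntegrable_angularSpeed,
      hc.geometricPhase_eq_pi_mul, _, hc.isParallelTransport hp, isFrameRotation_frameRotation hp _⟩,
    ⟨_, hol1, nonempty_zpowers_frameRotation_mulEquiv _ orderOf_exp_pi, ph1,
      ⟨_, isLoop_centralCircle hp 1, isSmoothSimpleClosed_centralCircle hp, ?_⟩,
      fun c hc hW => ?_⟩,
    ⟨_, hol2, nonempty_zpowers_frameRotation_mulEquiv _ orderOf_exp_pi_div_two, ph2,
      ⟨_, isLoop_diameterCircle hp 1, isSmoothSimpleClosed_diameterCircle hp,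
        ⟨_, diameterCircle_half p⟩, ?_⟩,
      fun c hc hz => ?_⟩⟩
  · rw [windingNumber_eq, angle_centralCircle hp]
    field_simp
    simp
  · have hθ : geometricPhase c = Real.pi := by rw [hc.geometricPhase_eq_pi_mul, hW, mul_one]
    refine ⟨hθ, fun T hT => ?_⟩
    rw [hT.unique (hc.isParallelTransport hp), hθ]
  · rw [windingNumber_eq, angle_diameterCircle hp]
    field_simp
    simp
  · obtain ⟨s, hs⟩ := hz
    have hW := hc.windingNumber_and_phase hs
    refine ⟨hW, fun h0 T hT => ?_⟩
    subst h0
    rw [hT.unique ((hc.isLoop hp).isParallelTransport hp)]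
    rcases hW with ⟨-, hθ⟩ | ⟨-, hθ⟩
    · rw [hθ]
    -- The opposite orientation gives the inverse rotation, which generates the same group.
    · rw [hθ, Circle.exp_neg, map_inv, Subgroup.zpowers_inv]
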